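/- Let $k$ be a commutative ring in which $2$ is invertible (for instance any commutative ring containing $\mathbb{Q}$), and let $(L,d,[\cdot,\cdot])$ be a differential $\mathbb{Z}$-graded Lie algebra over $k$, with $d$ of degree $+1$ and $[\cdot,\cdot]$ of degree $0$. Let $\eta:L\to L$ be a $k$-linear map of degree $-1$ with $d\eta d=d$, $\eta^2=0$ and $\eta d\eta=\eta$. Put $[d,\eta]=d\eta+\eta d$, $g=\eta[\cdot,\cdot]$, and $H=\ker[d,\eta]$ with the grading inherited from $L$. Notation. For homogeneous $a_1,\dots,a_n$ and $\sigma\in\Sigma_n$ let $\chi(\sigma)$ be the sign with $a_{\sigma(1)}\wedge\dots\wedge a_{\sigma(n)}=\chi(\sigma)\,a_1\wedge\dots\wedge a_n$ in the graded exterior algebra (where $a\wedge b=-(-1)^{|a||b|}b\wedge a$), and let $\alpha_n(a_1\otimes\dots\otimes a_n)=\sum_{\sigma\in\Sigma_n}\chi(\sigma)\,a_{\sigma(1)}\otimes\dots\otimes a_{\sigma(n)}$. Let $\mathrm{Sh}(p,n)\subset\Sigma_n$ be the set of permutations increasing on $\{1,\dots,p\}$ and on $\{p+1,\dots,n\}$.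 Let $\mathrm{Ot}(n)$ be the set of plane (oriented) binary trees with $n$ leaves; order the ramifications (internal vertices) and leaves of such a tree by listing the root first, then the left branch, then the right branch, recursively. Put $e(\phi)=(-1)^{w_\phi(1)+\dots+w_\phi(n)}$, where $w_\phi(i)=s_\phi(i)-(i-1)$ and $s_\phi(i)$ is the number of ramifications smaller than the $i$-th leaf. For a family $B=(b_K)$ of homogeneous bilinear maps $L\otimes L\to L$ indexed by the ramifications of $\phi$, written in the above order, let $\phi(B):L^{\otimes n}\to L$ be defined recursively: it is the identity for the tree with one leaf, and $\phi(B)=b_{\mathrm{root}}\circ(\phi_1(B_1)\otimes\phi_2(B_2))$ if $\phi$ has left branch $\phi_1$ and right branch $\phi_2$, with the Koszul convention $(f\otimes h)(x\otimes y)=(-1)^{|h||x|}f(x)\otimes h(y)$. Theorem. There are graded antisymmetric $k$-multilinear maps $\mu_n:H^{\otimes n}\to H$ of degree $2-n$ ($n\ge 0$), with $\mu_0=0$, $\mu_1=0$ and $$\mu_2=(1-d\eta)[\cdot,\cdot],\qquad \mu_n=\Big(\frac{-1}{2}\Big)^{n-1}\sum_{\phi\in\mathrm{Ot}(n)}e(\phi)\,\phi\big((1-[d,\eta])[\cdot,\cdot],g,\dots,g\big)\circ\alpha_n\quad\text{for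 all } n\ge 2$$ (in particular the two expressions for $\mu_2$ agree on $H$ and the right-hand sides take values in $H$), and these maps form a minimal $L_\infty$-algebra structure on the graded module $H$: for all $n\ge 0$ and all homogeneous $a_1,\dots,a_n\in H$, $$\sum_{p+l=n+1}\ \sum_{\sigma\in\mathrm{Sh}(p,n)}(-1)^{p(l-1)}\chi(\sigma)\,\mu_l\big(\mu_p(a_{\sigma(1)},\dots,a_{\sigma(p)}),a_{\sigma(p+1)},\dots,a_{\sigma(n)}\big)=0,$$ where $p\ge 0$ and $l\ge 1$. -/

import Mathlib

open scoped BigOperators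

/-! ### Koszul signs and shuffles -/

/-- The sign `χ(σ; a₁,…,aₙ)` with `a_{σ(1)} ∧ … ∧ a_{σ(n)} = χ(σ) a₁ ∧ … ∧ aₙ` in the graded exterior
algebra (relations `a ∧ b = -(-1)^{|a||b|} b ∧ a`), where `deg i` is the degree of `aᵢ`:
every inversion of `σ` contributes the factor `-(-1)^{|a||b|}`. -/
def koszulChi {n : ℕ} (σ : Equiv.Perm (Fin n)) (deg : Fin n → ℤ) : ℤˣ :=
  ∏ i : Fin n, ∏ j : Fin n,
    if i < j ∧ σ j < σ i then -Int.negOnePow (deg (σ i) * deg (σ j)) else 1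

/-- The shuffles `Sh(k,n)`: permutations of `n` letters that are increasing on the first `k`
positions and increasing on the last `n - k` positions. -/
def shuffles (k n : ℕ) : Finset (Equiv.Perm (Fin n)) :=
  Finset.univ.filter fun σ =>
    (∀ i j : Fin n, i < j → j.val < k → σ i < σ j) ∧
    (∀ i j : Fin n, k ≤ i.val → i < j → σ i < σ j)

/-! ### `L_∞`-algebras -/

/-- The sequence of `n`-ary maps `μ n` (`n ≥ 0`) is an `L_∞`-algebra structure on the
`ℤ`-graded `k`-module `V = ⨁ gr i`. -/
structure IsLInfinityAlgebra {k V : Type*} [CommRing k] [AddCommGroup V] [Module k V]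
    (gr : ℤ → Submodule k V) (μ : (n : ℕ) → MultilinearMap k (fun _ : Fin n => V) V) : Prop where
  isInternal : DirectSum.IsInternal gr
  /-- `μ n` has degree `2 - n`. -/
  degree : ∀ (n : ℕ) (deg : Fin n → ℤ) (a : Fin n → V), (∀ i, a i ∈ gr (deg i)) →
    μ n a ∈ gr (∑ i, deg i + 2 - n)
  /-- `μ n` is graded antisymmetric. -/
  antisymm : ∀ (n : ℕ) (deg : Fin n → ℤ) (a : Fin n → V), (∀ i, a i ∈ gr (deg i)) →
    ∀ σ : Equiv.Perm (Fin n), μ n (fun i => a (σ i)) = koszulChi σ deg • μ n a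
  /-- The generalised Jacobi identities
  `∑_{p+l=n+1} ∑_{σ ∈ Sh(p,n)} (-1)^{p(l-1)} χ(σ) μ_l(μ_p(a_{σ1},…,a_{σp}),a_{σ(p+1)},…,a_{σn}) = 0`
  (here `l = n - p + 1`). -/
  jacobi : ∀ (n : ℕ) (deg : Fin n → ℤ) (a : Fin n → V), (∀ i, a i ∈ gr (deg i)) →
    ∑ p : Fin (n + 1), ∑ σ ∈ shuffles p n,
      (Int.negOnePow ((p : ℤ) * ((n - p : ℕ) : ℤ)) * koszulChi σ deg) •
        μ (n - p + 1)
          (Fin.cons (μ p (fun i : Fin p => a (σ ⟨i.val, by omega⟩)))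
            (fun j : Fin (n - p) => a (σ ⟨p.val + j.val, by omega⟩))) = 0

/-- An `L_∞`-structure is minimal if it is uncurved (`μ₀ = 0`) and `μ₁ = 0`. -/
structure IsMinimalLInfinityAlgebra {k V : Type*} [CommRing k] [AddCommGroup V] [Module k V]
    (gr : ℤ → Submodule k V) (μ : (n : ℕ) → MultilinearMap k (fun _ : Fin n => V) V) : Prop
    extends IsLInfinityAlgebra gr μ where
  mu_zero : μ 0 = 0
  mu_one : μ 1 = 0

/-! ### Differential graded Lie algebras and splittings -/

/-- A differential graded Lie algebra structure on the `k`-module `L`, with a differential of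
degree `+1` and a bracket of degree `0`. -/
structure DGLieAlgebra (k L : Type*) [CommRing k] [AddCommGroup L] [Module k L] where
  gr : ℤ → Submodule k L
  isInternal : DirectSum.IsInternal gr
  d : L →ₗ[k] L
  bracket : L →ₗ[k] L →ₗ[k] L
  d_mem : ∀ (i : ℤ) (a : L), a ∈ gr i → d a ∈ gr (i + 1)
  d_d : ∀ a : L, d (d a) = 0
  bracket_mem : ∀ (i j : ℤ) (a b : L), a ∈ gr i → b ∈ gr j → bracket a b ∈ gr (i + j)
  bracket_antisymm : ∀ (i j : ℤ) (a b : L), a ∈ gr i → b ∈ gr j →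
    bracket a b = -(Int.negOnePow (i * j) • bracket b a)
  bracket_jacobi : ∀ (i j l : ℤ) (a b c : L), a ∈ gr i → b ∈ gr j → c ∈ gr l →
    bracket a (bracket b c) =
      bracket (bracket a b) c + Int.negOnePow (i * j) • bracket b (bracket a c)
  d_bracket : ∀ (i : ℤ) (a b : L), a ∈ gr i →
    d (bracket a b) = bracket (d a) b + Int.negOnePow i • bracket a (d b)

/-- A map `η` of degree `-1` with `dηd = d`, `η² = 0` and `ηdη = η`. -/
structure DGLieAlgebra.IsSplitting {k L : Type*} [CommRing k] [AddCommGroup L] [Module k L]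
    (A : DGLieAlgebra k L) (η : L →ₗ[k] L) : Prop where
  eta_mem : ∀ (i : ℤ) (a : L), a ∈ A.gr i → η a ∈ A.gr (i - 1)
  d_eta_d : ∀ a : L, A.d (η (A.d a)) = A.d a
  eta_eta : ∀ a : L, η (η a) = 0
  eta_d_eta : ∀ a : L, η (A.d (η a)) = η a

/-- The graded commutator `[d,η] = dη + ηd` (both maps are odd). -/
def DGLieAlgebra.comm {k L : Type*} [CommRing k] [AddCommGroup L] [Module k L]
    (A : DGLieAlgebra k L) (η : L →ₗ[k] L) : L →ₗ[k] L :=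
  A.d ∘ₗ η + η ∘ₗ A.d

/-- `H = ker [d,η]`. -/
def DGLieAlgebra.H {k L : Type*} [CommRing k] [AddCommGroup L] [Module k L]
    (A : DGLieAlgebra k L) (η : L →ₗ[k] L) : Submodule k L :=
  LinearMap.ker (A.comm η)

/-- The grading of `H` inherited from `L`. -/
def DGLieAlgebra.grH {k L : Type*} [CommRing k] [AddCommGroup L] [Module k L]
    (A : DGLieAlgebra k L) (η : L →ₗ[k] L) (i : ℤ) : Submodule k (A.H η) :=
  (A.gr i).comap (A.H η).subtype

/-! ### Oriented binary trees -/

/-- Equivalence classes of oriented binary trees with `n` leaves, i.e. plane binary trees: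
`nil` is the tree `τ` with one leaf and no ramification, `node _ φ₁ φ₂` has a root ramification with
left branch `φ₁` and right branch `φ₂`. -/
abbrev Ot (n : ℕ) : Type := {φ : BinaryTree Unit // φ.numLeaves = n}

instance Ot.fintype (n : ℕ) : Fintype (Ot n) :=
  match n with
  | 0 => ⟨∅, fun φ => absurd φ.2 φ.1.numLeaves_pos.ne'⟩
  | m + 1 => Fintype.subtype (BinaryTree.treesOfNumNodesEq m) fun φ => by
      rw [BinaryTree.mem_treesOfNumNodesEq, φ.numLeaves_eq_numNodes_succ, Nat.succ_inj]

/-- The list, over the leaves from left to right, of the numbers `s_φ(i)` of ramifications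
smaller than the `i`-th leaf. In the order on ramifications and leaves the root comes first, then
the left branch, then the right branch. -/
def ramificationsBefore : BinaryTree Unit → List ℕ
  | .nil => [0]
  | .node _ l r =>
      (ramificationsBefore l).map (fun s => s + 1) ++
        (ramificationsBefore r).map (fun s => s + (l.numNodes + 1))

/-- `e(φ) = (-1)^{w_φ(1)+…+w_φ(n)}`, where `w_φ(i) = s_φ(i) - (i - 1)`; in the list below
the positions are numbered from `0`. -/
def treeSign (φ : BinaryTree Unit) : ℤˣ :=
  Int.negOnePow
    (((ramificationsBefore φ).zipIdx.map fun p => (p.1 : ℤ) - (p.2 : ℤ)).sum)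

/-- A homogeneous bilinear map `L ⊗ L → L`, with its degree. -/
structure HomogeneousBilin {k L : Type*} [CommRing k] [AddCommGroup L] [Module k L]
    (gr : ℤ → Submodule k L) where
  deg : ℤ
  map : L →ₗ[k] L →ₗ[k] L
  map_mem : ∀ (i j : ℤ) (a b : L), a ∈ gr i → b ∈ gr j → map a b ∈ gr (i + j + deg)

/-- The degree of `φ(B)`: the sum of the degrees of all `b_K`. -/
def treeDegree {k L : Type*} [CommRing k] [AddCommGroup L] [Module k L]
    {gr : ℤ → Submodule k L} : BinaryTree (HomogeneousBilin gr) → ℤ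
  | .nil => 0
  | .node b l r => b.deg + treeDegree l + treeDegree r

/-- The value `φ(B)(a₁ ⊗ … ⊗ aₙ)` on homogeneous elements `aᵢ` of degree `deg i`, for a tree whose
ramifications `K` carry homogeneous bilinear maps `b_K`: `τ` gives the identity, and
`(φ₁ + φ₂)(B) = b₀ ∘ (φ₁(B₁) ⊗ φ₂(B₂))` with the Koszul convention
`(f ⊗ g)(x ⊗ y) = (-1)^{|g||x|} f(x) ⊗ g(y)`. -/
def treeEval {k L : Type*} [CommRing k] [AddCommGroup L] [Module k L]
    {gr : ℤ → Submodule k L} :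
    (φ : BinaryTree (HomogeneousBilin gr)) → (Fin φ.numLeaves → ℤ) → (Fin φ.numLeaves → L) → L
  | .nil, _, a => a (0 : Fin 1)
  | .node b l r, deg, a =>
      Int.negOnePow (treeDegree r * ∑ i : Fin l.numLeaves, deg (Fin.castAdd r.numLeaves i)) •
        b.map
          (treeEval l (fun i => deg (Fin.castAdd r.numLeaves i))
            (fun i => a (Fin.castAdd r.numLeaves i)))
          (treeEval r (fun i => deg (Fin.natAdd l.numLeaves i))
            (fun i => a (Fin.natAdd l.numLeaves i)))

/-- Put `b₀` on the root of a tree and `b` on all other ramifications. -/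
def decorate {β : Type*} (b₀ b : β) : BinaryTree Unit → BinaryTree β
  | .nil => .nil
  | .node _ l r => .node b₀ (l.map fun _ => b) (r.map fun _ => b)

theorem numLeaves_map_const {β : Type*} (b : β) (φ : BinaryTree Unit) :
    (φ.map fun _ => b).numLeaves = φ.numLeaves := by
  induction φ with
  | nil => rfl
  | node u l r ihl ihr => simp only [BinaryTree.map, BinaryTree.numLeaves, ihl, ihr]

theorem numLeaves_decorate {β : Type*} (b₀ b : β) (φ : BinaryTree Unit) :
    (decorate b₀ b φ).numLeaves = φ.numLeaves := by
  cases φ with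
  | nil => rfl
  | node u l r => simp only [decorate, BinaryTree.numLeaves, numLeaves_map_const]

/-! ### The brackets on `H` -/

/-- `g = η[·,·]`, of degree `-1`. -/
def DGLieAlgebra.IsSplitting.g {k L : Type*} [CommRing k] [AddCommGroup L] [Module k L]
    {A : DGLieAlgebra k L} {η : L →ₗ[k] L} (hη : A.IsSplitting η) : HomogeneousBilin A.gr where
  deg := -1
  map := A.bracket.compr₂ η
  map_mem i j a b ha hb := hη.eta_mem (i + j) _ (A.bracket_mem i j a b ha hb)

/-- `(1 - [d,η])[·,·]`, of degree `0`. -/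
def DGLieAlgebra.IsSplitting.projBracket {k L : Type*} [CommRing k] [AddCommGroup L] [Module k L]
    {A : DGLieAlgebra k L} {η : L →ₗ[k] L} (hη : A.IsSplitting η) : HomogeneousBilin A.gr where
  deg := 0
  map := A.bracket.compr₂ (LinearMap.id - A.comm η)
  map_mem i j a b ha hb := by
    have h := A.bracket_mem i j a b ha hb
    have h1 := A.d_mem _ _ (hη.eta_mem _ _ h)
    have h2 := hη.eta_mem _ _ (A.d_mem _ _ h)
    rw [sub_add_cancel] at h1
    rw [add_sub_cancel_right] at h2
    rw [add_zero]
    exact Submodule.sub_mem _ h (Submodule.add_mem _ h1 h2)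

/-- The value on homogeneous `a₁,…,aₙ` (of degrees `deg i`) of
`(-1/2)^{n-1} ∑_{φ ∈ Ot(n)} e(φ) φ((1-[d,η])[·,·], g, …, g) ∘ αₙ`, where
`αₙ(a₁ ⊗ … ⊗ aₙ) = ∑_σ χ(σ) a_{σ(1)} ⊗ … ⊗ a_{σ(n)}`. -/
def DGLieAlgebra.IsSplitting.treeBracket {k L : Type*} [CommRing k] [Invertible (2 : k)]
    [AddCommGroup L] [Module k L] {A : DGLieAlgebra k L} {η : L →ₗ[k] L}
    (hη : A.IsSplitting η) (n : ℕ) (deg : Fin n → ℤ) (a : Fin n → L) : L :=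
  (-⅟(2 : k)) ^ (n - 1) • ∑ φ : Ot n, treeSign φ.1 •
    ∑ σ : Equiv.Perm (Fin n), koszulChi σ deg •
      treeEval (decorate hη.projBracket hη.g φ.1)
        (fun i => deg (σ (Fin.cast ((numLeaves_decorate _ _ φ.1).trans φ.2) i)))
        (fun i => a (σ (Fin.cast ((numLeaves_decorate _ _ φ.1).trans φ.2) i)))

/-! The brackets are the Taylor coefficients of the obstruction to solving the Maurer-Cartan
equation, and the Jacobi identities come from evaluating that obstruction on one generic element.
Let `R` be a graded commutative algebra with square-zero generators `ε i` of degree `1 - |a i|`. In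
`R ⊗ L` the element `x = ∑ ε i ⊗ a i` has total degree 1, and on that degree the shifted bracket `B`
is symmetric and satisfies an unsigned Jacobi identity. Write `p = 1 - [d,η]` and solve `φ = x + ½ η
B(φ,φ)` recursively, one bracket at a time. Put `F(x) = ½ p B(φ,φ)`. Unfolding the recursion gives a
sum over plane binary trees with `p B` at the root and `η B` elsewhere, each ramification carrying a
factor ½; hence the coefficient of `ε 1 ⋯ ε n` in `F` is, up to sign, the tree bracket
(`F_eq_treeBracket`). Let `κ = dφ - ½ B(φ,φ)`. Elements of `H` are closed, so `dx = 0`; then `dη = 1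
- p - ηd`, the Leibniz rule and Jacobi give `κ = -F + η B(κ,φ)`. The derivative of `φ` in a
direction `y` solves `Dy = y + η B(Dy,φ)`, so `κ = -D(F)` because the recursions agree (`sum_D_F`).
The derivative of `F` in the direction `F` is therefore `p B(D(F),φ) = -p B(κ,φ) = p d(½ B(φ,φ))`,
which vanishes since `p d = 0` (`sum_DF_F`). To read off the identities on `a 1, …, a n`, a further
square-zero parameter `ζ` of degree `-1` turns the derivative into a first order expansion
(`F_add_mulLeft`). The coefficient of `ζ ε 1 ⋯ ε n` is the sum over shuffles, the inner bracket
coming from the direction `F` and the outer one from its derivative (`mulLeft_DF_F`). Only 2 is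
inverted. Square-zero generators replace the division by `n!` in polarization, and `B(B(x,x),x) = 0`
is obtained without dividing by 3. -/

open scoped TensorProduct
open Finset.HasAntidiagonal (antidiagonal)

/-! ### Nested antidiagonal sums -/

/-- The triples of natural numbers with sum `n`. -/
def antidiagonalTriple (n : ℕ) : Finset (ℕ × ℕ × ℕ) :=
  (Finset.range (n + 1) ×ˢ Finset.range (n + 1) ×ˢ Finset.range (n + 1)).filter
    fun x => x.1 + x.2.1 + x.2.2 = n

theorem mem_antidiagonalTriple {n : ℕ} {x : ℕ × ℕ × ℕ} :
    x ∈ antidiagonalTriple n ↔ x.1 + x.2.1 + x.2.2 = n := by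
  simp only [antidiagonalTriple, Finset.mem_filter, Finset.mem_product, Finset.mem_range]
  omega

theorem sum_antidiagonal_left {V : Type*} [AddCommMonoid V] (f : ℕ → ℕ → ℕ → V) (n : ℕ) :
    ∑ ij ∈ antidiagonal n, ∑ ab ∈ antidiagonal ij.1, f ab.1 ab.2 ij.2 =
      ∑ x ∈ antidiagonalTriple n, f x.1 x.2.1 x.2.2 := by
  rw [Finset.sum_sigma']
  refine Finset.sum_bij' (fun s _ => (s.2.1, s.2.2, s.1.2))
    (fun x _ => ⟨(x.1 + x.2.1, x.2.2), (x.1, x.2.1)⟩) ?_ ?_ ?_ ?_ ?_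
  · rintro ⟨⟨i, j⟩, a, b⟩ h
    simp only [Finset.mem_sigma, Finset.HasAntidiagonal.mem_antidiagonal, mem_antidiagonalTriple] at *
    omega
  · rintro ⟨a, b, c⟩ h
    exact Finset.mem_sigma.2 ⟨Finset.HasAntidiagonal.mem_antidiagonal.2
      (mem_antidiagonalTriple.1 h), Finset.HasAntidiagonal.mem_antidiagonal.2 rfl⟩
  · rintro ⟨⟨i, j⟩, a, b⟩ h
    simp only [Finset.mem_sigma, Finset.HasAntidiagonal.mem_antidiagonal] at *
    obtain ⟨-, rfl⟩ := h
    rfl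
  · rintro ⟨a, b, c⟩ h
    rfl
  · rintro ⟨⟨i, j⟩, a, b⟩ h
    rfl

theorem sum_antidiagonal_right {V : Type*} [AddCommMonoid V] (f : ℕ → ℕ → ℕ → V) (n : ℕ) :
    ∑ ij ∈ antidiagonal n, ∑ ab ∈ antidiagonal ij.2, f ij.1 ab.1 ab.2 =
      ∑ x ∈ antidiagonalTriple n, f x.1 x.2.1 x.2.2 := by
  rw [Finset.sum_sigma']
  refine Finset.sum_bij' (fun s _ => (s.1.1, s.2.1, s.2.2))
    (fun x _ => ⟨(x.1, x.2.1 + x.2.2), (x.2.1, x.2.2)⟩) ?_ ?_ ?_ ?_ ?_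
  · rintro ⟨⟨i, j⟩, a, b⟩ h
    simp only [Finset.mem_sigma, Finset.HasAntidiagonal.mem_antidiagonal, mem_antidiagonalTriple] at *
    omega
  · rintro ⟨a, b, c⟩ h
    exact Finset.mem_sigma.2 ⟨Finset.HasAntidiagonal.mem_antidiagonal.2
      ((add_assoc a b c).symm.trans (mem_antidiagonalTriple.1 h)),
      Finset.HasAntidiagonal.mem_antidiagonal.2 rfl⟩
  · rintro ⟨⟨i, j⟩, a, b⟩ h
    simp only [Finset.mem_sigma, Finset.HasAntidiagonal.mem_antidiagonal] at *
    obtain ⟨-, rfl⟩ := h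
    rfl
  · rintro ⟨a, b, c⟩ h
    rfl
  · rintro ⟨⟨i, j⟩, a, b⟩ h
    rfl

/-- A sum over all triples of a function with vanishing diagonal and vanishing sums over
the orbits of the rotation is zero; this holds without dividing by `3`. -/
theorem sum_antidiagonalTriple_eq_zero {V : Type*} [AddCommGroup V] (f : ℕ → ℕ → ℕ → V)
    (hdiag : ∀ a, f a a a = 0) (hcyc : ∀ a b c, f a b c + f b c a + f c a b = 0) (n : ℕ) :
    ∑ x ∈ antidiagonalTriple n, f x.1 x.2.1 x.2.2 = 0 := by
  have hrot : ∀ F : ℕ → ℕ → ℕ → V,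
      ∑ x ∈ antidiagonalTriple n, F x.1 x.2.1 x.2.2 =
        ∑ x ∈ antidiagonalTriple n, F x.2.1 x.2.2 x.1 := by
    intro F
    refine Finset.sum_bij' (fun x _ => (x.2.2, x.1, x.2.1)) (fun x _ => (x.2.1, x.2.2, x.1))
      ?_ ?_ ?_ ?_ ?_
    · intro x h
      simp only [mem_antidiagonalTriple] at *
      omega
    · intro x h
      simp only [mem_antidiagonalTriple] at *
      omega
    all_goals exact fun x _ => rfl
  -- `P` selects exactly one rotation of each nonconstant triple: the one starting at the first
  -- minimum of a cyclic run of minima.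
  let P : ℕ → ℕ → ℕ → Prop := fun a b c => a ≤ b ∧ a < c
  have hsplit : ∀ a b c, f a b c = (if P a b c then f a b c else 0) +
      (if P b c a then f a b c else 0) + (if P c a b then f a b c else 0) := by
    intro a b c
    by_cases h : a = b ∧ b = c
    · obtain ⟨rfl, rfl⟩ := h
      simp [hdiag]
    · have h1 : (P a b c ∧ ¬ P b c a ∧ ¬ P c a b) ∨ (¬ P a b c ∧ P b c a ∧ ¬ P c a b) ∨
          (¬ P a b c ∧ ¬ P b c a ∧ P c a b) := by
        simp only [P]
        omega
      rcases h1 with ⟨h1, h2, h3⟩ | ⟨h1, h2, h3⟩ | ⟨h1, h2, h3⟩ <;> simp [h1, h2, h3]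
  calc ∑ x ∈ antidiagonalTriple n, f x.1 x.2.1 x.2.2
      = ∑ x ∈ antidiagonalTriple n, (if P x.1 x.2.1 x.2.2 then f x.1 x.2.1 x.2.2 else 0) +
        ∑ x ∈ antidiagonalTriple n, (if P x.2.1 x.2.2 x.1 then f x.1 x.2.1 x.2.2 else 0) +
        ∑ x ∈ antidiagonalTriple n, (if P x.2.2 x.1 x.2.1 then f x.1 x.2.1 x.2.2 else 0) := by
          rw [← Finset.sum_add_distrib, ← Finset.sum_add_distrib]
          exact Finset.sum_congr rfl fun x _ => hsplit _ _ _
    _ = ∑ x ∈ antidiagonalTriple n, (if P x.1 x.2.1 x.2.2 then f x.1 x.2.1 x.2.2 else 0) +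
        ∑ x ∈ antidiagonalTriple n, (if P x.1 x.2.1 x.2.2 then f x.2.2 x.1 x.2.1 else 0) +
        ∑ x ∈ antidiagonalTriple n, (if P x.1 x.2.1 x.2.2 then f x.2.1 x.2.2 x.1 else 0) := by
          congr 1
          · congr 1
            rw [hrot fun a b c => if P a b c then f c a b else 0]
          · exact hrot fun a b c => if P c a b then f a b c else 0
    _ = 0 := by
          rw [← Finset.sum_add_distrib, ← Finset.sum_add_distrib]
          refine Finset.sum_eq_zero fun x _ => ?_
          split_ifs
          · rw [← hcyc x.1 x.2.1 x.2.2]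
            abel
          · simp

/-! ### Odd Lie structures with a splitting -/

/-- A differential with a splitting and a bracket which is symmetric on a submodule `V1` and has
there the properties of the shifted bracket of a differential graded Lie algebra on even
elements. -/
structure OddLie (k V : Type*) [CommRing k] [AddCommGroup V] [Module k V] where
  d : V →ₗ[k] V
  η : V →ₗ[k] V
  B : V →ₗ[k] V →ₗ[k] V
  V1 : Submodule k V
  d_d : ∀ v, d (d v) = 0
  d_eta_d : ∀ v, d (η (d v)) = d v
  mem : ∀ x ∈ V1, ∀ y ∈ V1, η (B x y) ∈ V1
  symm : ∀ x ∈ V1, ∀ y ∈ V1, B x y = B y x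
  jacobi : ∀ x ∈ V1, ∀ y ∈ V1, ∀ z ∈ V1, B (B x y) z + B (B y z) x + B (B z x) y = 0
  -- `jacobi` gives only three times this identity, and 3 need not be invertible.
  cubic : ∀ x ∈ V1, B (B x x) x = 0
  -- The differentiated factor always stands first, because `B` is symmetric only on `V1`, which
  -- need not contain `d x`.
  d_B : ∀ x ∈ V1, ∀ y ∈ V1, d (B x y) = -B (d x) y - B (d y) x

namespace OddLie

variable {k V : Type*} [CommRing k] [AddCommGroup V] [Module k V] (Q : OddLie k V)

/-- The projection `1 - [d,η]`. -/
def p : V →ₗ[k] V := LinearMap.id - (Q.d ∘ₗ Q.η + Q.η ∘ₗ Q.d)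

theorem p_apply (v : V) : Q.p v = v - (Q.d (Q.η v) + Q.η (Q.d v)) := rfl

theorem p_d (v : V) : Q.p (Q.d v) = 0 := by
  rw [p_apply, Q.d_eta_d, Q.d_d, map_zero, add_zero, sub_self]

section

variable [Invertible (2 : k)]

/-- The homogeneous components, by number of brackets, of the solution of
`φ = x + ½ η B(φ,φ)`. -/
def t (x : V) : ℕ → V
  | 0 => x
  | m + 1 => ⅟(2 : k) • Q.η (∑ i : Fin (m + 1), Q.B (t x i) (t x (m - i)))

/-- The homogeneous components of `½ (1-[d,η]) B(φ,φ)`. -/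
def F (x : V) : ℕ → V
  | 0 => 0
  | m + 1 => ⅟(2 : k) • Q.p (∑ ij ∈ antidiagonal m, Q.B (Q.t x ij.1) (Q.t x ij.2))

/-- The derivative of `t` in the direction `y`. -/
def D (x y : V) : ℕ → V
  | 0 => y
  -- The factor ½ of `t` is cancelled by the two equal contributions of the product rule.
  | m + 1 => Q.η (∑ i : Fin (m + 1), Q.B (D x y i) (Q.t x (m - i)))

/-- The derivative of `F` in the direction `y`. -/
def DF (x y : V) : ℕ → V
  | 0 => 0
  | m + 1 => Q.p (∑ ij ∈ antidiagonal m, Q.B (Q.D x y ij.1) (Q.t x ij.2))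

theorem t_zero (x : V) : Q.t x 0 = x := by rw [t]

theorem t_succ (x : V) (m : ℕ) : Q.t x (m + 1) =
    ⅟(2 : k) • Q.η (∑ ij ∈ antidiagonal m, Q.B (Q.t x ij.1) (Q.t x ij.2)) := by
  rw [t, Finset.Nat.sum_antidiagonal_eq_sum_range_succ_mk, Finset.sum_range]

theorem D_zero (x y : V) : Q.D x y 0 = y := by rw [D]

theorem D_succ (x y : V) (m : ℕ) : Q.D x y (m + 1) =
    Q.η (∑ ij ∈ antidiagonal m, Q.B (Q.D x y ij.1) (Q.t x ij.2)) := by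
  rw [D, Finset.Nat.sum_antidiagonal_eq_sum_range_succ_mk, Finset.sum_range]

theorem t_mem {x : V} (hx : x ∈ Q.V1) (m : ℕ) : Q.t x m ∈ Q.V1 := by
  induction m using Nat.strong_induction_on with
  | _ m ih =>
    cases m with
    | zero => rwa [t_zero]
    | succ m =>
      rw [t_succ, map_sum]
      refine Q.V1.smul_mem _ (Q.V1.sum_mem fun ij h => Q.mem _ (ih _ ?_) _ (ih _ ?_)) <;>
      · have := Finset.HasAntidiagonal.mem_antidiagonal.1 h
        omega

theorem D_sum {α : Type*} (x : V) (s : Finset α) (y : α → V) (m : ℕ) :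
    Q.D x (∑ i ∈ s, y i) m = ∑ i ∈ s, Q.D x (y i) m := by
  induction m using Nat.strong_induction_on with
  | _ m ih =>
    cases m with
    | zero => simp only [D_zero]
    | succ m =>
      simp only [D_succ]
      rw [← map_sum, Finset.sum_comm]
      congr 1
      refine Finset.sum_congr rfl fun ij h => ?_
      rw [ih _ (by have := Finset.HasAntidiagonal.mem_antidiagonal.1 h; omega), map_sum, LinearMap.sum_apply]

theorem DF_sum {α : Type*} (x : V) (s : Finset α) (y : α → V) (m : ℕ) :
    Q.DF x (∑ i ∈ s, y i) m = ∑ i ∈ s, Q.DF x (y i) m := by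
  cases m with
  | zero => simp only [DF, Finset.sum_const_zero]
  | succ m =>
    simp only [DF]
    rw [← map_sum, Finset.sum_comm]
    congr 1
    refine Finset.sum_congr rfl fun ij h => ?_
    rw [D_sum, map_sum, LinearMap.sum_apply]

/-- The sum of the brackets `B(t_i,t_j)` with `i + j + 1 = m`. -/
def S (x : V) : ℕ → V
  | 0 => 0
  | m + 1 => ∑ ij ∈ antidiagonal m, Q.B (Q.t x ij.1) (Q.t x ij.2)

/-- This is `B(B(φ,φ),φ) = 0` by components: in the sum over triples, rotation orbits cancel by
`jacobi` and constant triples by `cubic`. -/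
theorem sum_B_S {x : V} (hx : x ∈ Q.V1) (m : ℕ) :
    ∑ ij ∈ antidiagonal m, Q.B (Q.S x ij.1) (Q.t x ij.2) = 0 := by
  cases m with
  | zero => simp [S]
  | succ m =>
    rw [Finset.Nat.sum_antidiagonal_succ]
    simp only [S, map_zero, LinearMap.zero_apply, zero_add, map_sum, LinearMap.sum_apply]
    rw [sum_antidiagonal_left fun a b c => Q.B (Q.B (Q.t x a) (Q.t x b)) (Q.t x c)]
    exact sum_antidiagonalTriple_eq_zero _ (fun a => Q.cubic _ (Q.t_mem hx a))
      (fun a b c => Q.jacobi _ (Q.t_mem hx a) _ (Q.t_mem hx b) _ (Q.t_mem hx c)) m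

/-- The two Leibniz terms have equal sums, by reflecting the antidiagonal, and this absorbs the ½.
-/
theorem d_S {x : V} (hx : x ∈ Q.V1) (m : ℕ) :
    ⅟(2 : k) • Q.d (Q.S x (m + 1)) =
      -∑ ij ∈ antidiagonal m, Q.B (Q.d (Q.t x ij.1)) (Q.t x ij.2) := by
  have h : Q.d (Q.S x (m + 1)) =
      (2 : k) • -∑ ij ∈ antidiagonal m, Q.B (Q.d (Q.t x ij.1)) (Q.t x ij.2) := by
    simp only [S, map_sum]
    rw [Finset.sum_congr rfl fun ij _ => Q.d_B _ (Q.t_mem hx ij.1) _ (Q.t_mem hx ij.2),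
      Finset.sum_sub_distrib, two_smul, Finset.sum_neg_distrib, sub_eq_add_neg]
    congr 2
    exact Finset.Nat.sum_antidiagonal_swap
      (f := fun ij : ℕ × ℕ => Q.B (Q.d (Q.t x ij.1)) (Q.t x ij.2))
  rw [h, smul_smul, invOf_mul_self, one_smul]

/-- The curvature `d φ - ½ B(φ,φ)`, by components. -/
def curv (x : V) (m : ℕ) : V := Q.d (Q.t x m) - ⅟(2 : k) • Q.S x m

/-- The Bianchi identity: `B(B(φ,φ),φ)` drops out by Jacobi, and `B(dφ,φ)` is `-½ d B(φ,φ)` by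
Leibniz. -/
theorem sum_B_curv {x : V} (hx : x ∈ Q.V1) (m : ℕ) :
    ∑ ij ∈ antidiagonal m, Q.B (Q.curv x ij.1) (Q.t x ij.2) =
      -(⅟(2 : k) • Q.d (Q.S x (m + 1))) := by
  simp only [curv, map_sub, map_smul, LinearMap.sub_apply, LinearMap.smul_apply,
    Finset.sum_sub_distrib]
  rw [← Finset.smul_sum, Q.sum_B_S hx, d_S _ hx, smul_zero, sub_zero, neg_neg]

/-- Substitute `dη = 1 - p - ηd` in `d t = ½ dη S`: the 1 cancels against the curvature term, `p`
gives `F`, and `ηd` is rewritten by Bianchi. -/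
theorem curv_succ {x : V} (hx : x ∈ Q.V1) (m : ℕ) :
    Q.curv x (m + 1) = -Q.F x (m + 1) +
      Q.η (∑ ij ∈ antidiagonal m, Q.B (Q.curv x ij.1) (Q.t x ij.2)) := by
  rw [Q.sum_B_curv hx, curv, t_succ, F, p_apply, S]
  simp only [map_neg, map_smul, smul_sub, smul_add]
  abel

/-- Both sides solve the same recursion `v = F + η B(v,φ)`, which determines `v` component by
component; `d x = 0` supplies the initial value. -/
theorem sum_D_F {x : V} (hx : x ∈ Q.V1) (hd : Q.d x = 0) (m : ℕ) :
    ∑ ij ∈ antidiagonal m, Q.D x (Q.F x ij.1) ij.2 = -Q.curv x m := by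
  induction m using Nat.strong_induction_on with
  | _ m ih =>
    cases m with
    | zero => simp [D_zero, F, curv, t_zero, hd, S]
    | succ m =>
      rw [curv_succ _ hx, Finset.Nat.sum_antidiagonal_succ', D_zero]
      simp only [D_succ]
      -- Reassociating the triple sum makes the inner sum an instance of the induction hypothesis.
      rw [← map_sum, sum_antidiagonal_right
        fun a b c => Q.B (Q.D x (Q.F x a) b) (Q.t x c),
        ← sum_antidiagonal_left fun a b c => Q.B (Q.D x (Q.F x a) b) (Q.t x c)]
      rw [neg_add, neg_neg, ← map_neg, ← Finset.sum_neg_distrib]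
      congr 2
      refine Finset.sum_congr rfl fun ij h => ?_
      rw [← LinearMap.neg_apply, ← map_neg,
        ← ih _ (by have := Finset.HasAntidiagonal.mem_antidiagonal.1 h; omega), map_sum, LinearMap.sum_apply]

/-- The generalised Jacobi identities on one even element. -/
theorem sum_DF_F {x : V} (hx : x ∈ Q.V1) (hd : Q.d x = 0) (m : ℕ) :
    ∑ ij ∈ antidiagonal m, Q.DF x (Q.F x ij.1) ij.2 = 0 := by
  cases m with
  | zero => simp [DF]
  | succ m =>
    rw [Finset.Nat.sum_antidiagonal_succ']
    simp only [DF]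
    rw [← map_sum, sum_antidiagonal_right
        fun a b c => Q.B (Q.D x (Q.F x a) b) (Q.t x c),
        ← sum_antidiagonal_left fun a b c => Q.B (Q.D x (Q.F x a) b) (Q.t x c)]
    -- The inner sums are minus the curvature, so by Bianchi the whole argument of `p` is exact, and
    -- `p` kills exact elements.
    have h : ∑ ij ∈ antidiagonal m, ∑ ab ∈ antidiagonal ij.1,
        Q.B (Q.D x (Q.F x ab.1) ab.2) (Q.t x ij.2) =
        Q.d (⅟(2 : k) • Q.S x (m + 1)) := by
      rw [map_smul, ← neg_neg (⅟(2 : k) • Q.d (Q.S x (m + 1))), ← Q.sum_B_curv hx,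
        ← Finset.sum_neg_distrib]
      refine Finset.sum_congr rfl fun ij h => ?_
      rw [← LinearMap.neg_apply, ← map_neg, ← sum_D_F _ hx hd, map_sum, LinearMap.sum_apply]
    rw [h, p_d, zero_add]

/-- First order expansion along a linear endomorphism `Z` commuting with `η` and `B`. -/
theorem t_add {x y : V} {Z : V →ₗ[k] V} (hx : x ∈ Q.V1) (hη : ∀ v, Q.η (Z v) = Z (Q.η v))
    (hB : ∀ u v, Q.B (Z u) v = Z (Q.B u v)) (hD : ∀ m, Z (Q.D x y m) ∈ Q.V1)
    (hZ : ∀ m n, Q.B (Z (Q.D x y m)) (Z (Q.D x y n)) = 0) (m : ℕ) :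
    Q.t (x + Z y) m = Q.t x m + Z (Q.D x y m) := by
  induction m using Nat.strong_induction_on with
  | _ m ih =>
    cases m with
    | zero => simp only [t_zero, D_zero]
    | succ m =>
      have h : ∑ ij ∈ antidiagonal m, Q.B (Q.t (x + Z y) ij.1) (Q.t (x + Z y) ij.2) =
          ∑ ij ∈ antidiagonal m, Q.B (Q.t x ij.1) (Q.t x ij.2) +
          (2 : k) • Z (∑ ij ∈ antidiagonal m, Q.B (Q.D x y ij.1) (Q.t x ij.2)) := by
        rw [two_smul, map_sum]
        nth_rewrite 3 [← Finset.Nat.sum_antidiagonal_swap]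
        rw [← Finset.sum_add_distrib, ← Finset.sum_add_distrib]
        refine Finset.sum_congr rfl fun ij h => ?_
        have h' := Finset.HasAntidiagonal.mem_antidiagonal.1 h
        rw [ih _ (by omega), ih _ (by omega)]
        simp only [map_add, LinearMap.add_apply, hZ, add_zero, Prod.fst_swap, Prod.snd_swap]
        -- `Z` can be pulled out of the first slot only; `Z (D x y _)` lies in `V1`, so symmetry may
        -- bring it there.
        rw [Q.symm _ (Q.t_mem hx _) _ (hD _), hB, hB]
        abel
      rw [t_succ, t_succ, D_succ, h, map_add, smul_add, map_smul, smul_smul, invOf_mul_self,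
        one_smul, hη]

theorem F_add {x y : V} {Z : V →ₗ[k] V} (hx : x ∈ Q.V1) (hη : ∀ v, Q.η (Z v) = Z (Q.η v))
    (hp : ∀ v, Q.p (Z v) = Z (Q.p v))
    (hB : ∀ u v, Q.B (Z u) v = Z (Q.B u v)) (hD : ∀ m, Z (Q.D x y m) ∈ Q.V1)
    (hZ : ∀ m n, Q.B (Z (Q.D x y m)) (Z (Q.D x y n)) = 0) (m : ℕ) :
    Q.F (x + Z y) m = Q.F x m + Z (Q.DF x y m) := by
  cases m with
  | zero => simp [F, DF]
  | succ m =>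
    have h : ∑ ij ∈ antidiagonal m, Q.B (Q.t (x + Z y) ij.1) (Q.t (x + Z y) ij.2) =
        ∑ ij ∈ antidiagonal m, Q.B (Q.t x ij.1) (Q.t x ij.2) +
        (2 : k) • Z (∑ ij ∈ antidiagonal m, Q.B (Q.D x y ij.1) (Q.t x ij.2)) := by
      rw [two_smul, map_sum]
      nth_rewrite 3 [← Finset.Nat.sum_antidiagonal_swap]
      rw [← Finset.sum_add_distrib, ← Finset.sum_add_distrib]
      refine Finset.sum_congr rfl fun ij h => ?_
      rw [t_add _ hx hη hB hD hZ, t_add _ hx hη hB hD hZ]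
      simp only [map_add, LinearMap.add_apply, hZ, add_zero, Prod.fst_swap, Prod.snd_swap]
      rw [Q.symm _ (Q.t_mem hx _) _ (hD _), hB, hB]
      abel
    rw [F, F, DF, h, map_add, smul_add, map_smul, smul_smul, invOf_mul_self, one_smul, hp]

end

end OddLie

/-! ### Signs as scalars -/

/-- The sign `(-1)^n` as an element of a commutative ring. -/
def sg (k : Type*) [CommRing k] (n : ℤ) : k := ((Int.negOnePow n : ℤ) : k)

section sg

variable {k : Type*} [CommRing k]

theorem sg_add (a b : ℤ) : sg k (a + b) = sg k a * sg k b := by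
  simp [sg, Int.negOnePow_add]

theorem sg_congr {a b : ℤ} (h : Even a ↔ Even b) : sg k a = sg k b := by
  rw [sg, sg, (Int.negOnePow_eq_iff a b).2 (Int.even_sub.2 h)]

theorem sg_zero : sg k 0 = 1 := by simp [sg]

theorem sg_one : sg k 1 = -1 := by simp [sg]

theorem sg_add_one (a : ℤ) : sg k (a + 1) = -sg k a := by rw [sg_add, sg_one, mul_neg_one]

theorem sg_mul_self (a : ℤ) : sg k a * sg k a = 1 := by
  rw [← sg_add, ← sg_zero]
  exact sg_congr (by simp)

theorem negOnePow_smul {V : Type*} [AddCommGroup V] [Module k V] (n : ℤ) (v : V) :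
    Int.negOnePow n • v = sg k n • v := by
  rw [sg, Int.cast_smul_eq_zsmul, Units.smul_def]

theorem unit_smul (k : Type*) [CommRing k] {V : Type*} [AddCommGroup V] [Module k V] (u : ℤˣ)
    (v : V) : u • v = ((u : ℤ) : k) • v := by
  rw [Int.cast_smul_eq_zsmul, Units.smul_def]

end sg

/-! ### Graded commutative monomials -/

/-- A family of homogeneous elements of a `k`-algebra, closed under products, which commute up to
Koszul signs and have square zero. -/
structure IsGradedNil (k : Type*) {R : Type*} [CommRing k] [Ring R] [Algebra k R]
    (M : ℤ → R → Prop) : Prop where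
  smul : ∀ {a : ℤ} {r : R} (c : k), M a r → M a (c • r)
  mul : ∀ {a b : ℤ} {r s : R}, M a r → M b s → M (a + b) (r * s)
  comm : ∀ {a b : ℤ} {r s : R}, M a r → M b s → r * s = sg k (a * b) • (s * r)
  -- Here `M` is a predicate rather than a submodule: sums of square-zero monomials of even degree
  -- need not square to zero.
  sq : ∀ {a : ℤ} {r : R}, M a r → r * r = 0

section koszulProd

variable (k : Type*) {R J : Type*} [CommRing k] [Ring R] [Algebra k R]

/-- The product of the `r x`, where `x` runs through a list, with the sign which turns the
commutation rule of elements of degree `1 - deg x` into that of the graded exterior algebra. -/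
def koszulProd (deg : J → ℤ) (r : J → R) : List J → R
  | [] => 1
  | x :: w => sg k (deg x * w.length) • (r x * koszulProd deg r w)

variable {k}
variable {M : ℤ → R → Prop} {deg : J → ℤ} {r : J → R}

theorem koszulProd_map {J' : Type*} (g : J' → J) (w : List J') :
    koszulProd k deg r (w.map g) = koszulProd k (deg ∘ g) (r ∘ g) w := by
  induction w with
  | nil => rfl
  | cons x w ih => simp [koszulProd, ih]

/-- Every letter of `w` has `w'.length` additional letters to its right. -/
theorem koszulProd_append (w w' : List J) :
    koszulProd k deg r (w ++ w') =
      sg k ((w.map deg).sum * w'.length) • (koszulProd k deg r w * koszulProd k deg r w') := by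
  induction w with
  | nil => simp [koszulProd, sg_zero]
  | cons x w ih =>
    simp only [List.cons_append, koszulProd, ih, List.map_cons, List.sum_cons, mul_smul_comm,
      smul_mul_assoc, smul_smul, mul_assoc, ← sg_add, List.length_append]
    congr 2
    push_cast
    ring

/-- The empty word is excluded because its product is 1, which need not be in the square-zero family
`M`. -/
theorem koszulProd_mem (hM : IsGradedNil k M) (hr : ∀ x, M (1 - deg x) (r x)) (w : List J)
    (hw : w ≠ []) : M ((w.map fun x => 1 - deg x).sum) (koszulProd k deg r w) := by
  induction w with
  | nil => exact absurd rfl hw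
  | cons x w ih =>
    rw [koszulProd]
    refine hM.smul _ ?_
    by_cases h : w = []
    · subst h
      simpa [koszulProd] using hr x
    · simpa using hM.mul (hr x) (ih h)

theorem mul_koszulProd_eq_zero (hM : IsGradedNil k M) (hr : ∀ x, M (1 - deg x) (r x)) {a : ℤ}
    {s : R} (hs : M a s) {x : J} (hx : s * r x = 0) (w : List J) (hw : x ∈ w) :
    s * koszulProd k deg r w = 0 := by
  induction w with
  | nil => simp at hw
  | cons y w ih =>
    rw [koszulProd, mul_smul_comm, ← mul_assoc]
    rcases List.mem_cons.1 hw with rfl | h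
    · rw [hx, zero_mul, smul_zero]
    · rw [hM.comm hs (hr y), smul_mul_assoc, mul_assoc, ih h, mul_zero, smul_zero, smul_zero]

theorem koszulProd_eq_zero (hM : IsGradedNil k M) (hr : ∀ x, M (1 - deg x) (r x)) (w : List J)
    (hw : ¬ w.Pairwise fun x y => r x * r y ≠ 0) : koszulProd k deg r w = 0 := by
  induction w with
  | nil => simp at hw
  | cons x w ih =>
    rw [koszulProd]
    rw [List.pairwise_cons, not_and_or] at hw
    rcases hw with hw | hw
    · push Not at hw
      obtain ⟨y, hy, h⟩ := hw
      rw [mul_koszulProd_eq_zero hM hr (hr x) h w hy, smul_zero]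
    · rw [ih hw, mul_zero, smul_zero]

theorem koszulProd_ofFn_eq_zero (hM : IsGradedNil k M) (hr : ∀ x, M (1 - deg x) (r x)) {n : ℕ}
    {f : Fin n → J} {i j : Fin n} (hij : i ≠ j) (h : r (f i) * r (f j) = 0) :
    koszulProd k deg r (List.ofFn f) = 0 := by
  refine koszulProd_eq_zero hM hr _ fun hw => ?_
  rw [List.pairwise_ofFn] at hw
  rcases lt_or_gt_of_ne hij with h' | h'
  · exact hw h' h
  · refine hw h' ?_
    rw [hM.comm (hr _) (hr _), h, smul_zero]

/-- Décalage: for degrees `p`, `q`, the commutation exponent `(1-p)(1-q)` and the change `p + q` in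
the positional signs add up to `1 + pq` modulo 2. -/
theorem koszulProd_cons_cons (hM : IsGradedNil k M) (hr : ∀ x, M (1 - deg x) (r x)) (x y : J)
    (w : List J) : koszulProd k deg r (x :: y :: w) =
      (-sg k (deg x * deg y)) • koszulProd k deg r (y :: x :: w) := by
  simp only [koszulProd, mul_smul_comm, smul_smul, ← mul_assoc]
  rw [hM.comm (hr x) (hr y), smul_mul_assoc, smul_smul, ← sg_add_one]
  simp only [← sg_add]
  congr 1
  refine sg_congr ?_
  grind [Int.even_add, Int.even_sub, Int.not_even_one]

variable [LinearOrder J]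

/-- The Koszul sign of moving `x` to its place in the sorted list. -/
def insertSign (deg : J → ℤ) (x : J) (w : List J) : ℤˣ :=
  (w.map fun y => if y < x then -Int.negOnePow (deg x * deg y) else 1).prod

/-- The Koszul sign of sorting a list. -/
def sortSign (deg : J → ℤ) : List J → ℤˣ
  | [] => 1
  | x :: w => insertSign deg x w * sortSign deg w

theorem koszulProd_orderedInsert (hM : IsGradedNil k M) (hr : ∀ x, M (1 - deg x) (r x)) (x : J)
    (w : List J) (hw : w.Pairwise (· ≤ ·)) : koszulProd k deg r (x :: w) =
      ((insertSign deg x w : ℤ) : k) • koszulProd k deg r (w.orderedInsert (· ≤ ·) x) := by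
  induction w with
  | nil => simp [insertSign]
  | cons y w ih =>
    rw [List.pairwise_cons] at hw
    by_cases h : x ≤ y
    · rw [List.orderedInsert_cons_of_le _ _ h]
      have : insertSign deg x (y :: w) = 1 := by
        refine List.prod_eq_one fun u hu => ?_
        obtain ⟨z, hz, rfl⟩ := List.mem_map.1 hu
        rw [if_neg]
        rcases List.mem_cons.1 hz with rfl | hz
        · exact not_lt.2 h
        · exact not_lt.2 (h.trans (hw.1 z hz))
      rw [this]
      simp
    · have h' : List.orderedInsert (· ≤ ·) x (y :: w) =
          y :: List.orderedInsert (· ≤ ·) x w := by simp [List.orderedInsert, h]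
      have h2 : insertSign deg x (y :: w) = -Int.negOnePow (deg x * deg y) * insertSign deg x w := by
        simp [insertSign, not_le.1 h]
      rw [h', koszulProd_cons_cons hM hr, koszulProd, ih hw.2, koszulProd, h2]
      simp only [List.length_cons, List.orderedInsert_length, mul_smul_comm, smul_smul]
      congr 1
      simp only [Units.val_mul, Units.val_neg, Int.cast_mul, Int.cast_neg, sg]
      ring

theorem koszulProd_sort (hM : IsGradedNil k M) (hr : ∀ x, M (1 - deg x) (r x)) (w : List J) :
    koszulProd k deg r w =
      ((sortSign deg w : ℤ) : k) • koszulProd k deg r (w.insertionSort (· ≤ ·)) := by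
  induction w with
  | nil => simp [sortSign]
  | cons x w ih =>
    rw [List.insertionSort_cons]
    have h : koszulProd k deg r (x :: w) =
        ((sortSign deg w : ℤ) : k) • koszulProd k deg r (x :: w.insertionSort (· ≤ ·)) := by
      rw [koszulProd, ih, koszulProd, List.length_insertionSort, mul_smul_comm, smul_comm]
    rw [h, koszulProd_orderedInsert hM hr _ _ (List.pairwise_insertionSort _ _), smul_smul,
      sortSign]
    -- The insertion sign depends only on which letters are present, not on their order, so it
    -- counts the inversions of the unsorted word.
    have h2 : insertSign deg x (w.insertionSort (· ≤ ·)) = insertSign deg x w :=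
      ((List.perm_insertionSort (· ≤ ·) w).map _).prod_eq
    rw [h2]
    push_cast
    rw [mul_comm]

theorem sortSign_ofFn {n : ℕ} (f : Fin n → J) : sortSign deg (List.ofFn f) =
    ∏ i : Fin n, ∏ j : Fin n,
      if i < j ∧ f j < f i then -Int.negOnePow (deg (f i) * deg (f j)) else 1 := by
  induction n with
  | zero => simp [sortSign]
  | succ n ih =>
    rw [List.ofFn_succ, sortSign, ih, Fin.prod_univ_succ]
    congr 1
    · rw [insertSign, List.map_ofFn, List.prod_ofFn, Fin.prod_univ_succ]
      simp
    · refine Finset.prod_congr rfl fun i _ => ?_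
      rw [Fin.prod_univ_succ]
      simp

end koszulProd

theorem koszulProd_perm {k R : Type*} [CommRing k] [Ring R] [Algebra k R] {M : ℤ → R → Prop}
    {n : ℕ} {deg : Fin n → ℤ} {r : Fin n → R} (hM : IsGradedNil k M)
    (hr : ∀ x, M (1 - deg x) (r x)) (σ : Equiv.Perm (Fin n)) :
    koszulProd k deg r (List.ofFn σ) =
      ((koszulChi σ deg : ℤ) : k) • koszulProd k deg r (List.finRange n) := by
  rw [koszulProd_sort hM hr, sortSign_ofFn]
  congr 2
  refine List.Perm.eq_of_pairwise (fun a b _ _ => le_antisymm) (List.pairwise_insertionSort _ _)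
    (List.pairwise_le_finRange n) ((List.perm_insertionSort _ _).trans ?_)
  rw [← List.map_id (List.ofFn σ), ← List.ofFn_id, List.map_id]
  exact (Equiv.Perm.ofFn_comp_perm σ id)

/-! ### Extension of scalars to graded commutative monomials -/

/-- The linear operator which multiplies the elements of degree `i` by `(-1)^i`. -/
noncomputable def signOp {k L : Type*} [CommRing k] [AddCommGroup L] [Module k L]
    {gr : ℤ → Submodule k L} (h : DirectSum.IsInternal gr) : L →ₗ[k] L :=
  DirectSum.toModule k ℤ L (fun i => sg k i • (gr i).subtype) ∘ₗ
    (LinearEquiv.ofBijective (DirectSum.coeLinearMap gr) h).symm.toLinearMap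

theorem coeLinearMap_symm_apply {k L : Type*} [CommRing k] [AddCommGroup L] [Module k L]
    {gr : ℤ → Submodule k L} (h : DirectSum.IsInternal gr) {i : ℤ} {u : L} (hu : u ∈ gr i) :
    (LinearEquiv.ofBijective (DirectSum.coeLinearMap gr) h).symm u =
      DirectSum.lof k ℤ (fun i => gr i) i ⟨u, hu⟩ := by
  rw [LinearEquiv.symm_apply_eq]
  exact (DirectSum.coeLinearMap_lof gr i ⟨u, hu⟩).symm

theorem signOp_apply {k L : Type*} [CommRing k] [AddCommGroup L] [Module k L]
    {gr : ℤ → Submodule k L} (h : DirectSum.IsInternal gr) {i : ℤ} {u : L} (hu : u ∈ gr i) :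
    signOp h u = sg k i • u := by
  rw [signOp, LinearMap.comp_apply, LinearEquiv.coe_coe, coeLinearMap_symm_apply h hu,
    DirectSum.toModule_lof]
  rfl

section

variable {k L R : Type*} [CommRing k] [AddCommGroup L] [Module k L] [Ring R] [Algebra k R]

/-- The elements of total degree `m` in `R ⊗ L`. -/
def totalDegree (M : ℤ → R → Prop) (gr : ℤ → Submodule k L) (m : ℤ) : Submodule k (R ⊗[k] L) :=
  Submodule.span k {v | ∃ i r u, M (m - i) r ∧ u ∈ gr i ∧ v = r ⊗ₜ[k] u}

theorem tmul_mem_totalDegree {M : ℤ → R → Prop} {gr : ℤ → Submodule k L} {m a i : ℤ} {r : R}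
    {u : L} (hr : M a r) (hu : u ∈ gr i) (h : a + i = m) :
    r ⊗ₜ[k] u ∈ totalDegree M gr m := by
  refine Submodule.subset_span ⟨i, r, u, ?_, hu, rfl⟩
  rwa [← h, add_sub_cancel_right]

/-- No scalar case is needed, since `M` absorbs scalars. The additive case keeps the memberships
because the cubic identity is not additive and uses them. -/
theorem totalDegree_induction {M : ℤ → R → Prop} (hM : IsGradedNil k M)
    {gr : ℤ → Submodule k L} {m : ℤ} {P : R ⊗[k] L → Prop}
    (tmul : ∀ i r u, M (m - i) r → u ∈ gr i → P (r ⊗ₜ[k] u)) (zero : P 0)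
    (add : ∀ x ∈ totalDegree M gr m, ∀ y ∈ totalDegree M gr m, P x → P y → P (x + y)) :
    ∀ x ∈ totalDegree M gr m, P x := by
  intro x hx
  suffices h : ∀ c : k, P (c • x) by simpa using h 1
  refine Submodule.span_induction (p := fun x _ => ∀ c : k, P (c • x)) ?_ ?_ ?_ ?_ hx
  · rintro _ ⟨i, r, u, hr, hu, rfl⟩ c
    rw [TensorProduct.smul_tmul']
    exact tmul i _ u (hM.smul c hr) hu
  · intro c
    rwa [smul_zero]
  · intro x y hx hy h1 h2 c
    rw [smul_add]
    exact add _ (Submodule.smul_mem _ c hx) _ (Submodule.smul_mem _ c hy) (h1 c) (h2 c)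
  · intro a x _ h c
    rw [smul_smul]
    exact h _

variable (R) (A : DGLieAlgebra k L)

/-- The bracket `B(r ⊗ u, s ⊗ v) = (-1)^{|u|} rs ⊗ [u,v]`. -/
noncomputable def tensorBracket : R ⊗[k] L →ₗ[k] R ⊗[k] L →ₗ[k] R ⊗[k] L :=
  TensorProduct.map₂ (LinearMap.mul k R) (A.bracket ∘ₗ signOp A.isInternal)

variable {R A}

theorem tensorBracket_tmul {i : ℤ} {u : L} (hu : u ∈ A.gr i) (r s : R) (v : L) :
    tensorBracket R A (r ⊗ₜ u) (s ⊗ₜ v) = sg k i • ((r * s) ⊗ₜ A.bracket u v) := by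
  rw [tensorBracket, TensorProduct.map₂_apply_tmul, LinearMap.comp_apply,
    signOp_apply A.isInternal hu, map_smul, TensorProduct.map_tmul, LinearMap.smul_apply,
    TensorProduct.tmul_smul]
  rfl

/-- No sign appears, because the scalar passes nothing: this is associativity in `R`. -/
theorem tensorBracket_rTensor_mulLeft (s : R) (x y : R ⊗[k] L) :
    tensorBracket R A ((LinearMap.mulLeft k s).rTensor L x) y =
      (LinearMap.mulLeft k s).rTensor L (tensorBracket R A x y) := by
  induction x with
  | zero => simp
  | add x x' h h' => simp only [map_add, LinearMap.add_apply, h, h']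
  | tmul r u =>
    induction y with
    | zero => simp
    | add y y' h h' => simp only [map_add, h, h']
    | tmul r' u' => simp [tensorBracket, mul_assoc]

variable {M : ℤ → R → Prop}

theorem tensorBracket_mem (hM : IsGradedNil k M) {m n : ℤ} : ∀ x ∈ totalDegree M A.gr m,
    ∀ y ∈ totalDegree M A.gr n, tensorBracket R A x y ∈ totalDegree M A.gr (m + n) := by
  refine totalDegree_induction hM ?_ (by simp) ?_
  · intro i r u hr hu
    refine totalDegree_induction hM ?_ (by simp) ?_
    · intro j s v hs hv
      rw [tensorBracket_tmul hu]
      exact Submodule.smul_mem _ _ (tmul_mem_totalDegree (hM.mul hr hs)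
        (A.bracket_mem _ _ _ _ hu hv) (by ring))
    · intro x _ y _ h1 h2
      rw [map_add]
      exact Submodule.add_mem _ h1 h2
  · intro x _ y _ h1 h2 z hz
    rw [map_add]
    exact Submodule.add_mem _ (h1 z hz) (h2 z hz)

theorem lTensor_eta_mem (hM : IsGradedNil k M) {η : L →ₗ[k] L} (hη : A.IsSplitting η) {m n : ℤ}
    (h : m = n + 1) : ∀ x ∈ totalDegree M A.gr m, η.lTensor R x ∈ totalDegree M A.gr n := by
  refine totalDegree_induction hM ?_ (by simp) ?_
  · intro i r u hr hu
    exact tmul_mem_totalDegree hr (hη.eta_mem i u hu) (by omega)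
  · intro x _ y _ h1 h2
    rw [map_add]
    exact Submodule.add_mem _ h1 h2

theorem tensorBracket_symm (hM : IsGradedNil k M) : ∀ x ∈ totalDegree M A.gr 1, ∀ y ∈ totalDegree M A.gr 1,
    tensorBracket R A x y = tensorBracket R A y x := by
  refine totalDegree_induction hM ?_ (by simp) ?_
  · intro i r u hr hu
    refine totalDegree_induction hM ?_ (by simp) ?_
    · intro j s v hs hv
      rw [tensorBracket_tmul hu, tensorBracket_tmul hv, hM.comm hr hs,
        A.bracket_antisymm i j u v hu hv, negOnePow_smul (k := k), ← neg_smul, TensorProduct.tmul_smul,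
        ← TensorProduct.smul_tmul', smul_smul, smul_smul, ← sg_add_one, ← sg_add, ← sg_add]
      congr 1
      refine sg_congr ?_
      grind [Int.even_add, Int.even_sub, Int.not_even_one]
    · intro x _ y _ h1 h2
      simp only [map_add, LinearMap.add_apply, h1, h2]
  · intro x _ y _ h1 h2 z hz
    simp only [map_add, LinearMap.add_apply, h1 z hz, h2 z hz]

theorem tensorBracket_jacobi_tmul (hM : IsGradedNil k M) {i j l : ℤ} {r s t : R} {u v w : L} (hr : M (1 - i) r)
    (hs : M (1 - j) s) (ht : M (1 - l) t) (hu : u ∈ A.gr i) (hv : v ∈ A.gr j)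
    (hw : w ∈ A.gr l) :
    tensorBracket R A (tensorBracket R A (r ⊗ₜ u) (s ⊗ₜ v)) (t ⊗ₜ w) +
      tensorBracket R A (tensorBracket R A (s ⊗ₜ v) (t ⊗ₜ w)) (r ⊗ₜ u) +
      tensorBracket R A (tensorBracket R A (t ⊗ₜ w) (r ⊗ₜ u)) (s ⊗ₜ v) = 0 := by
  have huv := A.bracket_mem _ _ _ _ hu hv
  have hvw := A.bracket_mem _ _ _ _ hv hw
  have hwu := A.bracket_mem _ _ _ _ hw hu
  -- All three terms are brought to multiples of `rst ⊗ [[u,v],w]` and `rst ⊗ [v,[u,w]]`; what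
  -- remains is parity.
  have e1 : s * t * r = sg k ((1 - j + (1 - l)) * (1 - i)) • (r * s * t) := by
    rw [hM.comm (hM.mul hs ht) hr, mul_assoc]
  have e2 : t * r * s = sg k ((1 - l) * (1 - i + (1 - j))) • (r * s * t) := by
    rw [mul_assoc, hM.comm ht (hM.mul hr hs)]
  have b1 : A.bracket (A.bracket v w) u =
      sg k ((j + l) * i + 1) • A.bracket u (A.bracket v w) := by
    rw [A.bracket_antisymm _ _ _ _ hvw hu, negOnePow_smul (k := k), ← neg_smul, ← sg_add_one]
  have b2 : A.bracket (A.bracket w u) v =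
      (sg k (l * i + 1) * sg k ((i + l) * j + 1)) • A.bracket v (A.bracket u w) := by
    rw [A.bracket_antisymm _ _ _ _ hw hu, negOnePow_smul (k := k), ← neg_smul, ← sg_add_one, map_smul,
      LinearMap.smul_apply, A.bracket_antisymm _ _ _ _ (A.bracket_mem _ _ _ _ hu hw) hv,
      negOnePow_smul (k := k), ← neg_smul, ← sg_add_one, smul_smul]
  have b3 := A.bracket_jacobi _ _ _ _ _ _ hu hv hw
  rw [negOnePow_smul (k := k)] at b3
  rw [tensorBracket_tmul hu, tensorBracket_tmul hv, tensorBracket_tmul hw]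
  simp only [map_smul, LinearMap.smul_apply]
  rw [tensorBracket_tmul huv, tensorBracket_tmul hvw, tensorBracket_tmul hwu, e1, e2, b1, b2, b3]
  simp only [TensorProduct.tmul_add, TensorProduct.tmul_smul, ← TensorProduct.smul_tmul',
    smul_add, smul_smul, ← sg_add]
  have s1 : sg k (j + (j + l + ((j + l) * i + 1 + (1 - j + (1 - l)) * (1 - i)))) =
      -sg k (i + (i + j)) := by
    rw [← sg_add_one]
    exact sg_congr (by grind [Int.even_add, Int.even_sub, Int.not_even_one])
  have s2 : sg k (l + (l + i + (l * i + 1 + ((i + l) * j + 1) + (1 - l) * (1 - i + (1 - j))))) =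
      -sg k (j + (j + l + ((j + l) * i + 1 + i * j + (1 - j + (1 - l)) * (1 - i)))) := by
    rw [← sg_add_one]
    exact sg_congr (by grind [Int.even_add, Int.even_sub, Int.not_even_one])
  rw [s1, s2]
  module

theorem tensorBracket_jacobi (hM : IsGradedNil k M) : ∀ x ∈ totalDegree M A.gr 1,
    ∀ y ∈ totalDegree M A.gr 1, ∀ z ∈ totalDegree M A.gr 1,
    tensorBracket R A (tensorBracket R A x y) z + tensorBracket R A (tensorBracket R A y z) x +
      tensorBracket R A (tensorBracket R A z x) y = 0 := by
  have key : ∀ a b c a' b' c' : R ⊗[k] L, a + b + c = 0 → a' + b' + c' = 0 →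
      a + a' + (b + b') + (c + c') = 0 := by
    intro a b c a' b' c' h h'
    rw [← add_zero (0 : R ⊗[k] L)]
    nth_rewrite 1 [← h]
    rw [← h']
    abel
  refine totalDegree_induction hM ?_ (by simp) ?_
  · intro i r u hr hu
    refine totalDegree_induction hM ?_ (by simp) ?_
    · intro j s v hs hv
      refine totalDegree_induction hM ?_ (by simp) ?_
      · intro l t w ht hw
        exact tensorBracket_jacobi_tmul hM hr hs ht hu hv hw
      · intro x _ y _ h1 h2
        simp only [map_add, LinearMap.add_apply]
        exact key _ _ _ _ _ _ h1 h2
    · intro x _ y _ h1 h2 z hz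
      simp only [map_add, LinearMap.add_apply]
      exact key _ _ _ _ _ _ (h1 z hz) (h2 z hz)
  · intro x _ y _ h1 h2 z hz w hw
    simp only [map_add, LinearMap.add_apply]
    exact key _ _ _ _ _ _ (h1 z hz w hw) (h2 z hz w hw)

/-- Pure tensors satisfy it since `r * r = 0`. For a sum, the mixed terms are exactly the Jacobi
relations on `x, x, y` and `y, y, x`, so nothing is divided by 3. -/
theorem tensorBracket_cubic (hM : IsGradedNil k M) : ∀ x ∈ totalDegree M A.gr 1,
    tensorBracket R A (tensorBracket R A x x) x = 0 := by
  refine totalDegree_induction hM ?_ (by simp) ?_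
  · intro i r u hr hu
    rw [tensorBracket_tmul hu, hM.sq hr, TensorProduct.zero_tmul, smul_zero, map_zero,
      LinearMap.zero_apply]
  · intro x hx y hy h1 h2
    have hxy := tensorBracket_symm hM x hx y hy
    have j1 := tensorBracket_jacobi hM x hx x hx y hy
    have j2 := tensorBracket_jacobi hM y hy y hy x hx
    rw [← hxy] at j1 j2
    simp only [map_add, LinearMap.add_apply, ← hxy, h1, h2, zero_add, add_zero]
    rw [← add_zero (0 : R ⊗[k] L)]
    nth_rewrite 1 [← j1]
    rw [← j2]
    abel

/-- Although `d` acts without a sign past `R`, the factor `(-1)^{|u|}` in the bracket changes when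
`u` is replaced by `d u`. -/
theorem d_tensorBracket (hM : IsGradedNil k M) : ∀ x ∈ totalDegree M A.gr 1,
    ∀ y ∈ totalDegree M A.gr 1, A.d.lTensor R (tensorBracket R A x y) =
      -tensorBracket R A (A.d.lTensor R x) y - tensorBracket R A (A.d.lTensor R y) x := by
  refine totalDegree_induction hM ?_ (by simp) ?_
  · intro i r u hr hu
    refine totalDegree_induction hM ?_ (by simp) ?_
    · intro j s v hs hv
      have hdv := A.d_mem _ _ hv
      rw [tensorBracket_tmul hu, map_smul, LinearMap.lTensor_tmul, LinearMap.lTensor_tmul,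
        LinearMap.lTensor_tmul, tensorBracket_tmul (A.d_mem _ _ hu), tensorBracket_tmul hdv,
        A.d_bracket i u v hu, A.bracket_antisymm _ _ _ _ hdv hu, hM.comm hs hr,
        negOnePow_smul (k := k), negOnePow_smul (k := k), ← neg_smul, ← sg_add_one]
      simp only [TensorProduct.tmul_add, TensorProduct.tmul_smul, ← TensorProduct.smul_tmul',
        smul_add, smul_smul, ← sg_add]
      have s1 : sg k (j + 1 + ((j + 1) * i + 1 + (1 - j) * (1 - i))) = -sg k (i + i) := by
        rw [← sg_add_one]
        exact sg_congr (by grind [Int.even_add, Int.even_sub, Int.not_even_one])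
      have s2 : sg k (i + 1) = -sg k i := sg_add_one i
      rw [s1, s2]
      module
    · intro x _ y _ h1 h2
      simp only [map_add, LinearMap.add_apply, h1, h2]
      abel
  · intro x _ y _ h1 h2 z hz
    simp only [map_add, LinearMap.add_apply, h1 z hz, h2 z hz]
    abel

/-- The shifted Lie structure on `R ⊗ L`. -/
noncomputable def tensorOddLie (hM : IsGradedNil k M) {η : L →ₗ[k] L} (hη : A.IsSplitting η) :
    OddLie k (R ⊗[k] L) where
  d := A.d.lTensor R
  η := η.lTensor R
  B := tensorBracket R A
  V1 := totalDegree M A.gr 1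
  d_d v := by
    have h : A.d ∘ₗ A.d = 0 := LinearMap.ext A.d_d
    rw [← LinearMap.lTensor_comp_apply, h, LinearMap.lTensor_zero, LinearMap.zero_apply]
  d_eta_d v := by
    have h : (A.d ∘ₗ η) ∘ₗ A.d = A.d := LinearMap.ext hη.d_eta_d
    rw [← LinearMap.lTensor_comp_apply, ← LinearMap.lTensor_comp_apply, h]
  mem x hx y hy := lTensor_eta_mem hM hη (by norm_num) _ (tensorBracket_mem hM x hx y hy)
  symm := tensorBracket_symm hM
  jacobi := tensorBracket_jacobi hM
  cubic := tensorBracket_cubic hM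
  d_B := d_tensorBracket hM

theorem tensorOddLie_p (hM : IsGradedNil k M) {η : L →ₗ[k] L} (hη : A.IsSplitting η) :
    (tensorOddLie (R := R) hM hη).p = (LinearMap.id - A.comm η).lTensor R := by
  rw [OddLie.p, DGLieAlgebra.comm, LinearMap.lTensor_sub, LinearMap.lTensor_add,
    LinearMap.lTensor_comp, LinearMap.lTensor_comp, LinearMap.lTensor_id]
  rfl

theorem tensorOddLie_D_mem [Invertible (2 : k)] (hM : IsGradedNil k M) {η : L →ₗ[k] L}
    (hη : A.IsSplitting η) {x y : R ⊗[k] L} (hx : x ∈ totalDegree M A.gr 1)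
    (hy : y ∈ totalDegree M A.gr 2) (m : ℕ) :
    (tensorOddLie hM hη).D x y m ∈ totalDegree M A.gr 2 := by
  induction m using Nat.strong_induction_on with
  | _ m ih =>
    cases m with
    | zero => rwa [OddLie.D_zero]
    | succ m =>
      rw [OddLie.D_succ, map_sum]
      refine Submodule.sum_mem _ fun ij h => ?_
      exact lTensor_eta_mem hM hη (by norm_num) _ (tensorBracket_mem (m := 2) (n := 1) hM _
        (ih _ (by have := Finset.HasAntidiagonal.mem_antidiagonal.1 h; omega)) _
        ((tensorOddLie hM hη).t_mem hx _))

end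

/-! ### Sums over plane binary trees -/

theorem sum_treesOfNumNodesEq_succ {V : Type*} [AddCommMonoid V] (G : BinaryTree Unit → V)
    (m : ℕ) : ∑ φ ∈ BinaryTree.treesOfNumNodesEq (m + 1), G φ =
      ∑ ij ∈ antidiagonal m, ∑ l ∈ BinaryTree.treesOfNumNodesEq ij.1,
        ∑ r ∈ BinaryTree.treesOfNumNodesEq ij.2, G (.node () l r) := by
  rw [BinaryTree.treesOfNumNodesEq_succ, Finset.sum_biUnion]
  · refine Finset.sum_congr rfl fun ij _ => ?_
    rw [BinaryTree.pairwiseNode, Finset.sum_map, Finset.sum_product]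
    rfl
  · simp_rw [Set.PairwiseDisjoint, Set.Pairwise, Finset.disjoint_left]
    aesop

/-- The iterated brackets `η B` along a tree, all leaves being `x`. -/
def OddLie.tree {k V : Type*} [CommRing k] [AddCommGroup V] [Module k V] (Q : OddLie k V) (x : V) :
    BinaryTree Unit → V
  | .nil => x
  | .node _ l r => Q.η (Q.B (Q.tree x l) (Q.tree x r))

/-- As `OddLie.tree`, with the projection `1 - [d,η]` instead of `η` at the root. -/
def OddLie.rootTree {k V : Type*} [CommRing k] [AddCommGroup V] [Module k V] (Q : OddLie k V)
    (x : V) : BinaryTree Unit → V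
  | .nil => 0
  | .node _ l r => Q.p (Q.B (Q.tree x l) (Q.tree x r))

section

variable {k V : Type*} [CommRing k] [AddCommGroup V] [Module k V] [Invertible (2 : k)]
  (Q : OddLie k V) (x : V)

/-- Unfolding the recursion, each ramification contributes one `η B` and one factor ½. -/
theorem OddLie.t_eq_sum_tree (m : ℕ) :
    Q.t x m = ⅟(2 : k) ^ m • ∑ φ ∈ BinaryTree.treesOfNumNodesEq m, Q.tree x φ := by
  induction m using Nat.strong_induction_on with
  | _ m ih =>
    cases m with
    | zero => simp [t_zero, tree]
    | succ m =>
      rw [t_succ, sum_treesOfNumNodesEq_succ, pow_succ', mul_smul, map_sum]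
      congr 1
      rw [Finset.smul_sum]
      refine Finset.sum_congr rfl fun ij h => ?_
      have h' := Finset.HasAntidiagonal.mem_antidiagonal.1 h
      rw [ih _ (by omega), ih _ (by omega), ← h', pow_add]
      simp only [tree, map_smul, map_sum, LinearMap.smul_apply, LinearMap.sum_apply]
      rw [← Finset.smul_sum, smul_smul, mul_comm, Finset.sum_comm]

theorem OddLie.F_eq_sum_rootTree (m : ℕ) : Q.F x (m + 1) =
    ⅟(2 : k) ^ (m + 1) • ∑ φ ∈ BinaryTree.treesOfNumNodesEq (m + 1), Q.rootTree x φ := by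
  rw [F, sum_treesOfNumNodesEq_succ, pow_succ', mul_smul, map_sum]
  congr 1
  rw [Finset.smul_sum]
  refine Finset.sum_congr rfl fun ij h => ?_
  have h' := Finset.HasAntidiagonal.mem_antidiagonal.1 h
  rw [t_eq_sum_tree, t_eq_sum_tree, ← h', pow_add]
  simp only [rootTree, map_smul, map_sum, LinearMap.smul_apply, LinearMap.sum_apply]
  rw [← Finset.smul_sum, smul_smul, mul_comm, Finset.sum_comm]

end

/-! ### The sign of a tree -/

theorem length_ramificationsBefore (φ : BinaryTree Unit) :
    (ramificationsBefore φ).length = φ.numLeaves := by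
  induction φ with
  | nil => rfl
  | node _ l r hl hr => simp [ramificationsBefore, BinaryTree.numLeaves, hl, hr]

theorem sum_zipIdx_map_sub (w : List ℕ) (c m : ℕ) :
    (((w.map fun s => s + c).zipIdx m).map fun p => (p.1 : ℤ) - (p.2 : ℤ)).sum =
      ((w.zipIdx.map fun p => (p.1 : ℤ) - (p.2 : ℤ)).sum) + ((c : ℤ) - m) * w.length := by
  have h : ∀ (w : List ℕ) (c m m' : ℕ),
      (((w.map fun s => s + c).zipIdx m).map fun p => (p.1 : ℤ) - (p.2 : ℤ)).sum =
      (((w.zipIdx m').map fun p => (p.1 : ℤ) - (p.2 : ℤ)).sum) +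
        ((c : ℤ) - m + m') * w.length := by
    intro w c
    induction w with
    | nil => simp
    | cons a w ih =>
      intro m m'
      simp only [List.map_cons, List.zipIdx_cons, List.sum_cons, ih (m + 1) (m' + 1),
        List.length_cons]
      push_cast
      ring
  simpa using h w c m 0

/-- The new root raises each count on the left by 1. On the right the counts and the positions both
shift by `l.numLeaves = l.numNodes + 1`, so nothing changes. -/
theorem treeSign_node (u : Unit) (l r : BinaryTree Unit) :
    treeSign (.node u l r) = treeSign l * treeSign r * Int.negOnePow l.numLeaves := by
  rw [treeSign, treeSign, treeSign, ← Int.negOnePow_add, ← Int.negOnePow_add]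
  congr 1
  rw [ramificationsBefore, List.zipIdx_append, List.map_append, List.sum_append,
    sum_zipIdx_map_sub, sum_zipIdx_map_sub]
  simp only [List.length_map, length_ramificationsBefore, l.numLeaves_eq_numNodes_succ]
  push_cast
  ring

/-! ### Evaluation of trees in the extension of scalars -/

section

variable {k L : Type*} [CommRing k] [AddCommGroup L] [Module k L]

theorem treeEval_mem {gr : ℤ → Submodule k L} (Ψ : BinaryTree (HomogeneousBilin gr))
    (deg : Fin Ψ.numLeaves → ℤ) (a : Fin Ψ.numLeaves → L) (ha : ∀ i, a i ∈ gr (deg i)) :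
    treeEval Ψ deg a ∈ gr (∑ i, deg i + treeDegree Ψ) := by
  induction Ψ with
  | nil =>
    have h : ∑ i, deg i + treeDegree (BinaryTree.nil : BinaryTree (HomogeneousBilin gr)) =
        deg (0 : Fin 1) := by
      rw [treeDegree, add_zero]
      exact Fin.sum_univ_one deg
    rw [h]
    exact ha _
  | node b l r hl hr =>
    rw [treeEval, negOnePow_smul (k := k)]
    refine Submodule.smul_mem _ _ ?_
    have h : ∑ i, deg i + treeDegree (.node b l r) =
        (∑ i, deg (Fin.castAdd r.numLeaves i) + treeDegree l) +
          (∑ i, deg (Fin.natAdd l.numLeaves i) + treeDegree r) + b.deg := by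
      rw [treeDegree]
      have h1 : ∑ i, deg i = ∑ i, deg (Fin.castAdd r.numLeaves i) +
          ∑ i, deg (Fin.natAdd l.numLeaves i) := Fin.sum_univ_add deg
      rw [h1]
      ring
    rw [h]
    exact b.map_mem _ _ _ _ (hl _ _ fun i => ha _) (hr _ _ fun i => ha _)

theorem treeDegree_map_g {A : DGLieAlgebra k L} {η : L →ₗ[k] L} (hη : A.IsSplitting η)
    (φ : BinaryTree Unit) : treeDegree (φ.map fun _ => hη.g) = -(φ.numNodes : ℤ) := by
  induction φ with
  | nil => rfl
  | node u l r hl hr =>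
    rw [BinaryTree.map, treeDegree, hl, hr, BinaryTree.numNodes]
    push_cast
    simp only [DGLieAlgebra.IsSplitting.g]
    ring

variable {R J : Type*} [Ring R] [Algebra k R] [Fintype J] {M : ℤ → R → Prop}
  {A : DGLieAlgebra k L} {η : L →ₗ[k] L} {deg : J → ℤ} {r : J → R} {b : J → L}

/-- The inductive step for both kinds of node: `h` is `η` at an inner ramification and `1 - [d,η]`
at the root. A word on the leaves of the tree is a pair of words on the branches. -/
theorem node_expansion (hη : A.IsSplitting η) (hb : ∀ j, b j ∈ A.gr (deg j))
    (b₀ : HomogeneousBilin A.gr)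
    (h : L →ₗ[k] L) (hb₀ : b₀.map = A.bracket.compr₂ h) (φ₁ φ₂ : BinaryTree Unit)
    {x y : R ⊗[k] L}
    (hx : x = ∑ f : Fin (φ₁.map fun _ => hη.g).numLeaves → J,
      (sg k φ₁.numNodes * ((treeSign φ₁ : ℤ) : k)) • (koszulProd k deg r (List.ofFn f) ⊗ₜ[k]
        treeEval (φ₁.map fun _ => hη.g) (fun i => deg (f i)) (fun i => b (f i))))
    (hy : y = ∑ f : Fin (φ₂.map fun _ => hη.g).numLeaves → J,
      (sg k φ₂.numNodes * ((treeSign φ₂ : ℤ) : k)) • (koszulProd k deg r (List.ofFn f) ⊗ₜ[k]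
        treeEval (φ₂.map fun _ => hη.g) (fun i => deg (f i)) (fun i => b (f i)))) :
    h.lTensor R (tensorBracket R A x y) =
      ∑ f : Fin (BinaryTree.node b₀ (φ₁.map fun _ => hη.g) (φ₂.map fun _ => hη.g)).numLeaves → J,
        (sg k (BinaryTree.node () φ₁ φ₂).numNodes *
          ((treeSign (.node () φ₁ φ₂) : ℤ) : k)) • (koszulProd k deg r (List.ofFn f) ⊗ₜ[k]
        treeEval (.node b₀ (φ₁.map fun _ => hη.g) (φ₂.map fun _ => hη.g))
          (fun i => deg (f i)) (fun i => b (f i))) := by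
  refine Eq.trans ?_ (Equiv.sum_comp
    (Fin.appendEquiv (φ₁.map fun _ => hη.g).numLeaves (φ₂.map fun _ => hη.g).numLeaves) _)
  rw [hx, hy, Fintype.sum_prod_type]
  simp only [map_sum, LinearMap.sum_apply]
  rw [Finset.sum_comm]
  refine Finset.sum_congr rfl fun f₁ _ => Finset.sum_congr rfl fun f₂ _ => ?_
  have hu := treeEval_mem (φ₁.map fun _ => hη.g) (fun i => deg (f₁ i)) (fun i => b (f₁ i))
    fun i => hb _
  have hK : koszulProd k deg r (List.ofFn (n := (BinaryTree.node b₀ (φ₁.map fun _ => hη.g)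
      (φ₂.map fun _ => hη.g)).numLeaves) (Fin.append f₁ f₂)) = sg k ((∑ i, deg (f₁ i)) * (φ₂.numNodes + 1)) •
        (koszulProd k deg r (List.ofFn f₁) * koszulProd k deg r (List.ofFn f₂)) := by
    have hN : ((φ₂.map fun _ => hη.g).numLeaves : ℤ) = φ₂.numNodes + 1 := by
      rw [numLeaves_map_const, φ₂.numLeaves_eq_numNodes_succ]
      push_cast
      rfl
    change koszulProd k deg r (List.ofFn (Fin.append f₁ f₂)) = _
    rw [List.ofFn_fin_append, koszulProd_append, List.map_ofFn, List.sum_ofFn, List.length_ofFn, hN]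
    rfl
  rw [treeDegree_map_g] at hu
  simp only [map_smul, LinearMap.smul_apply]
  rw [tensorBracket_tmul hu, map_smul, LinearMap.lTensor_tmul]
  simp only [Fin.appendEquiv, Equiv.coe_fn_mk, treeEval, Fin.append_left, Fin.append_right, hb₀,
    LinearMap.compr₂_apply]
  rw [hK, negOnePow_smul (k := k), TensorProduct.tmul_smul, ← TensorProduct.smul_tmul',
    treeDegree_map_g, treeSign_node, BinaryTree.numNodes, φ₁.numLeaves_eq_numNodes_succ]
  simp only [smul_smul]
  congr 1
  -- On the left is the sign of the shifted bracket; on the right are the tree sign, the Koszul sign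
  -- of `treeEval` and the sign of concatenating words.
  have h1 : sg k (φ₂.numNodes : ℤ) * sg k (φ₁.numNodes : ℤ) *
      sg k (∑ i, deg (f₁ i) + -(φ₁.numNodes : ℤ)) =
      sg k ((φ₁.numNodes + φ₂.numNodes + 1 : ℕ) : ℤ) * sg k ((φ₁.numNodes + 1 : ℕ) : ℤ) *
        sg k (-(φ₂.numNodes : ℤ) * ∑ i, deg (f₁ i)) *
        sg k ((∑ i, deg (f₁ i)) * (φ₂.numNodes + 1)) := by
    simp only [← sg_add]
    push_cast
    generalize (φ₁.numNodes : ℤ) = p, (φ₂.numNodes : ℤ) = q, ∑ i, deg (f₁ i) = s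
    exact sg_congr (by grind [Int.even_add, Int.not_even_one])
  rw [Units.val_mul, Units.val_mul, Int.cast_mul, Int.cast_mul]
  have h2 : ((Int.negOnePow ((φ₁.numNodes + 1 : ℕ) : ℤ) : ℤ) : k) =
      sg k ((φ₁.numNodes + 1 : ℕ) : ℤ) := rfl
  rw [h2]
  linear_combination ((treeSign φ₁ : ℤ) : k) * ((treeSign φ₂ : ℤ) : k) * h1

end

/-! ### Expansion of the tree sums -/

section

variable {k L R J : Type*} [CommRing k] [AddCommGroup L] [Module k L] [Ring R] [Algebra k R]
  [Fintype J] {M : ℤ → R → Prop}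
  {A : DGLieAlgebra k L} {η : L →ₗ[k] L} {deg : J → ℤ} {r : J → R} {b : J → L}

theorem tree_expansion (hM : IsGradedNil k M) (hη : A.IsSplitting η)
    (hb : ∀ j, b j ∈ A.gr (deg j)) (φ : BinaryTree Unit) :
    (tensorOddLie hM hη).tree (∑ j, r j ⊗ₜ[k] b j) φ =
      ∑ f : Fin (φ.map fun _ => hη.g).numLeaves → J,
        (sg k φ.numNodes * ((treeSign φ : ℤ) : k)) • (koszulProd k deg r (List.ofFn f) ⊗ₜ[k]
        treeEval (φ.map fun _ => hη.g) (fun i => deg (f i)) (fun i => b (f i))) := by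
  induction φ with
  | nil =>
    refine Eq.trans ?_ (Equiv.sum_comp (Equiv.funUnique (Fin 1) J).symm _)
    rw [OddLie.tree]
    refine Finset.sum_congr rfl fun j _ => ?_
    have h1 : sg k (BinaryTree.nil (α := Unit)).numNodes * ((treeSign .nil : ℤ) : k) = 1 := by
      simp [treeSign, ramificationsBefore, BinaryTree.numNodes, sg_zero]
    have h2 : koszulProd k deg r (List.ofFn (n := (BinaryTree.map (fun _ : Unit => hη.g)
        .nil).numLeaves) ((Equiv.funUnique (Fin 1) J).symm j)) = r j := by
      change koszulProd k deg r [j] = r j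
      simp [koszulProd, sg_zero]
    rw [h1, h2, one_smul]
    rfl
  | node u φ₁ φ₂ h₁ h₂ => exact node_expansion hη hb hη.g η rfl φ₁ φ₂ h₁ h₂

theorem rootTree_expansion (hM : IsGradedNil k M) (hη : A.IsSplitting η)
    (hb : ∀ j, b j ∈ A.gr (deg j)) (φ : BinaryTree Unit) (hφ : φ ≠ .nil) :
    (tensorOddLie hM hη).rootTree (∑ j, r j ⊗ₜ[k] b j) φ =
      ∑ f : Fin (decorate hη.projBracket hη.g φ).numLeaves → J,
        (sg k φ.numNodes * ((treeSign φ : ℤ) : k)) • (koszulProd k deg r (List.ofFn f) ⊗ₜ[k]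
        treeEval (decorate hη.projBracket hη.g φ) (fun i => deg (f i)) (fun i => b (f i))) := by
  cases φ with
  | nil => exact absurd rfl hφ
  | node u φ₁ φ₂ =>
    rw [OddLie.rootTree, tensorOddLie_p]
    exact node_expansion hη hb hη.projBracket _ rfl φ₁ φ₂ (tree_expansion hM hη hb φ₁)
      (tree_expansion hM hη hb φ₂)

/-- The tree sum of `treeBracket`, without the antisymmetrization. -/
noncomputable def DGLieAlgebra.IsSplitting.treeSum [Invertible (2 : k)] (hη : A.IsSplitting η)
    (n : ℕ) (deg : Fin n → ℤ) (a : Fin n → L) : L :=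
  (-⅟(2 : k)) ^ (n - 1) • ∑ φ : Ot n, treeSign φ.1 •
    treeEval (decorate hη.projBracket hη.g φ.1)
      (fun i => deg (Fin.cast ((numLeaves_decorate _ _ φ.1).trans φ.2) i))
      (fun i => a (Fin.cast ((numLeaves_decorate _ _ φ.1).trans φ.2) i))

theorem treeBracket_eq_sum_treeSum [Invertible (2 : k)] (hη : A.IsSplitting η) (n : ℕ)
    (deg : Fin n → ℤ) (a : Fin n → L) : hη.treeBracket n deg a =
      ∑ σ : Equiv.Perm (Fin n), ((koszulChi σ deg : ℤ) : k) •
        hη.treeSum n (fun i => deg (σ i)) (fun i => a (σ i)) := by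
  simp only [DGLieAlgebra.IsSplitting.treeBracket, DGLieAlgebra.IsSplitting.treeSum,
    unit_smul k, Finset.smul_sum]
  rw [Finset.sum_comm]
  refine Finset.sum_congr rfl fun σ _ => Finset.sum_congr rfl fun φ _ => ?_
  simp only [smul_smul]
  congr 1
  ring

/-- A tree with `m + 2` leaves has `m + 1` ramifications; the resulting sign `(-1)^(m+1)` turns the
powers of ½ into powers of `-½`. Words may still repeat letters here. -/
theorem F_expansion [Invertible (2 : k)] (hM : IsGradedNil k M) (hη : A.IsSplitting η)
    (hb : ∀ j, b j ∈ A.gr (deg j)) (m : ℕ) :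
    (tensorOddLie hM hη).F (∑ j, r j ⊗ₜ[k] b j) (m + 1) =
      ∑ f : Fin (m + 2) → J, koszulProd k deg r (List.ofFn f) ⊗ₜ[k]
        hη.treeSum (m + 2) (fun i => deg (f i)) (fun i => b (f i)) := by
  have h : ∀ φ : Ot (m + 2), (tensorOddLie hM hη).rootTree (∑ j, r j ⊗ₜ[k] b j) φ.1 =
      ∑ f : Fin (m + 2) → J, (sg k ((m + 1 : ℕ) : ℤ) * ((treeSign φ.1 : ℤ) : k)) •
        (koszulProd k deg r (List.ofFn f) ⊗ₜ[k] treeEval (decorate hη.projBracket hη.g φ.1)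
          (fun i => deg (f (Fin.cast ((numLeaves_decorate _ _ φ.1).trans φ.2) i)))
          (fun i => b (f (Fin.cast ((numLeaves_decorate _ _ φ.1).trans φ.2) i)))) := by
    intro φ
    have hn : φ.1.numNodes = m + 1 := by
      have := φ.2
      rw [φ.1.numLeaves_eq_numNodes_succ] at this
      omega
    rw [rootTree_expansion hM hη hb φ.1 (by
      intro h0
      rw [h0] at hn
      simp [BinaryTree.numNodes] at hn), hn]
    refine (Equiv.sum_comp (Equiv.arrowCongr
      (finCongr ((numLeaves_decorate hη.projBracket hη.g φ.1).trans φ.2)).symm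
      (Equiv.refl J)) _).symm.trans ?_
    refine Finset.sum_congr rfl fun f _ => ?_
    have hf : List.ofFn (Equiv.arrowCongr
        (finCongr ((numLeaves_decorate hη.projBracket hη.g φ.1).trans φ.2)).symm
        (Equiv.refl J) f) = List.ofFn f :=
      (List.ofFn_congr ((numLeaves_decorate hη.projBracket hη.g φ.1).trans φ.2).symm f).symm
    rw [hf]
    rfl
  have hs : ∑ φ ∈ BinaryTree.treesOfNumNodesEq (m + 1),
      (tensorOddLie hM hη).rootTree (∑ j, r j ⊗ₜ[k] b j) φ =
      ∑ φ : Ot (m + 2), (tensorOddLie hM hη).rootTree (∑ j, r j ⊗ₜ[k] b j) φ.1 := by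
    refine Finset.sum_subtype _ (fun φ => ?_) _
    rw [BinaryTree.mem_treesOfNumNodesEq, φ.numLeaves_eq_numNodes_succ, Nat.succ_inj]
  rw [OddLie.F_eq_sum_rootTree, hs, Finset.sum_congr rfl fun φ _ => h φ, Finset.sum_comm,
    Finset.smul_sum]
  refine Finset.sum_congr rfl fun f _ => ?_
  have h2 : (-⅟(2 : k)) ^ (m + 1) = ⅟(2 : k) ^ (m + 1) * sg k ((m + 1 : ℕ) : ℤ) := by
    rw [neg_pow, sg, Int.cast_negOnePow_natCast, mul_comm]
  rw [DGLieAlgebra.IsSplitting.treeSum, show m + 2 - 1 = m + 1 from rfl, h2,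
    TensorProduct.tmul_smul, mul_smul, TensorProduct.tmul_sum, Finset.smul_sum, Finset.smul_sum,
    Finset.smul_sum]
  refine Finset.sum_congr rfl fun φ _ => ?_
  rw [unit_smul k, TensorProduct.tmul_smul, mul_smul]

end

/-! ### Antisymmetrization from square-zero generators -/

section

variable {k L R : Type*} [CommRing k] [Invertible (2 : k)] [AddCommGroup L] [Module k L] [Ring R]
  [Algebra k R] {M : ℤ → R → Prop} {A : DGLieAlgebra k L} {η : L →ₗ[k] L}

theorem sum_perm_koszulProd_tmul_treeSum {J : Type*} (hM : IsGradedNil k M)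
    (hη : A.IsSplitting η) {n : ℕ} {deg : J → ℤ} {r : J → R} {b : J → L}
    (hr : ∀ j, M (1 - deg j) (r j)) (g : Fin n → J) :
    ∑ σ : Equiv.Perm (Fin n), koszulProd k deg r (List.ofFn fun i => g (σ i)) ⊗ₜ[k]
        hη.treeSum n (fun i => deg (g (σ i))) (fun i => b (g (σ i))) =
      koszulProd k deg r (List.ofFn g) ⊗ₜ[k]
        hη.treeBracket n (fun i => deg (g i)) (fun i => b (g i)) := by
  rw [treeBracket_eq_sum_treeSum, TensorProduct.tmul_sum]
  refine Finset.sum_congr rfl fun σ _ => ?_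
  have h : koszulProd k deg r (List.ofFn fun i => g (σ i)) =
      ((koszulChi σ (deg ∘ g) : ℤ) : k) • koszulProd k deg r (List.ofFn g) := by
    have := koszulProd_perm (deg := deg ∘ g) (r := r ∘ g) hM (fun j => hr (g j)) σ
    rw [← koszulProd_map, ← koszulProd_map, List.map_ofFn, ← List.ofFn_eq_map] at this
    exact this
  rw [h, TensorProduct.tmul_smul, TensorProduct.smul_tmul']
  rfl

/-- Words with a repeated letter vanish. The others are permutations of the generators, and sorting
their monomials produces the signs of the antisymmetrization. -/
theorem F_eq_treeBracket (hM : IsGradedNil k M) (hη : A.IsSplitting η) {m : ℕ}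
    {deg : Fin (m + 2) → ℤ} {r : Fin (m + 2) → R} {b : Fin (m + 2) → L}
    (hr : ∀ j, M (1 - deg j) (r j)) (hb : ∀ j, b j ∈ A.gr (deg j)) :
    (tensorOddLie hM hη).F (∑ j, r j ⊗ₜ[k] b j) (m + 1) =
      koszulProd k deg r (List.finRange (m + 2)) ⊗ₜ[k] hη.treeBracket (m + 2) deg b := by
  rw [F_expansion hM hη hb, ← List.ofFn_id]
  refine Eq.trans ?_ (sum_perm_koszulProd_tmul_treeSum hM hη hr id)
  symm
  refine Finset.sum_of_injOn (fun σ : Equiv.Perm (Fin (m + 2)) => (σ : Fin (m + 2) → Fin (m + 2)))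
    (fun σ _ τ _ h => DFunLike.coe_injective h) (by simp) ?_ fun σ _ => rfl
  intro f _ hf
  have hf' : ¬ Function.Injective f := fun hi => hf
    ⟨Equiv.ofBijective f (Finite.injective_iff_bijective.1 hi), by simp, rfl⟩
  rw [Function.not_injective_iff] at hf'
  obtain ⟨i, j, hij, hne⟩ := hf'
  rw [koszulProd_ofFn_eq_zero hM hr hne, TensorProduct.zero_tmul]
  rw [hij]
  exact hM.sq (hr _)

end

/-! ### A graded commutative algebra with given generators -/

section

variable {k R J : Type*} [CommRing k] [Ring R] [Algebra k R]

/-- The scalar multiples of nonempty products of generators `ε i` of degree `e i`. -/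
inductive IsMonomial (k : Type*) {R J : Type*} [CommRing k] [Ring R] [Algebra k R] (e : J → ℤ)
    (ε : J → R) : ℤ → R → Prop
  | gen (i : J) : IsMonomial k e ε (e i) (ε i)
  | smul {a : ℤ} {r : R} (c : k) : IsMonomial k e ε a r → IsMonomial k e ε a (c • r)
  | mul {a b : ℤ} {r s : R} :
      IsMonomial k e ε a r → IsMonomial k e ε b s → IsMonomial k e ε (a + b) (r * s)

/-- Relations on generators propagate to monomials; in particular `(rs)(rs)` is a sign times
`(rr)(ss)`. -/
theorem isGradedNil_isMonomial {e : J → ℤ} {ε : J → R}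
    (hcomm : ∀ i j, ε i * ε j = sg k (e i * e j) • (ε j * ε i)) (hsq : ∀ i, ε i * ε i = 0) :
    IsGradedNil k (IsMonomial k e ε) := by
  have hgen : ∀ (i : J) {b : ℤ} {s : R}, IsMonomial k e ε b s →
      ε i * s = sg k (e i * b) • (s * ε i) := by
    intro i b s hs
    induction hs with
    | gen j => exact hcomm i j
    | smul c _ h => rw [mul_smul_comm, h, smul_mul_assoc, smul_comm]
    | mul _ _ h1 h2 =>
      rw [← mul_assoc, h1, smul_mul_assoc, mul_assoc, h2, mul_smul_comm, smul_smul, mul_add,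
        sg_add, mul_assoc]
  have hc : ∀ {a b : ℤ} {r s : R}, IsMonomial k e ε a r → IsMonomial k e ε b s →
      r * s = sg k (a * b) • (s * r) := by
    intro a b r s hr hs
    induction hr with
    | gen i => exact hgen i hs
    | smul c _ h => rw [mul_smul_comm, smul_mul_assoc, h, smul_comm]
    | mul _ _ h1 h2 =>
      rw [mul_assoc, h2, mul_smul_comm, ← mul_assoc, h1, smul_mul_assoc, smul_smul, add_mul,
        sg_add, mul_assoc, mul_comm (sg k _)]
  refine ⟨IsMonomial.smul, IsMonomial.mul, hc, fun hr => ?_⟩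
  induction hr with
  | gen i => exact hsq i
  | smul c _ h => rw [mul_smul_comm, smul_mul_assoc, h, smul_zero, smul_zero]
  | @mul a b r s hr hs h1 h2 =>
    rw [mul_assoc, ← mul_assoc s r s, hc hs hr, smul_mul_assoc, mul_smul_comm, mul_assoc r s s, h2,
      mul_zero, mul_zero, smul_zero]

end

/-! ### A model by creation operators on subsets -/

section

variable (k : Type*) [CommRing k] {n : ℕ} (e : Fin n → ℤ)

/-- The sign of inserting the generator `i` into the ordered product over `T`. -/
def createSign (i : Fin n) (T : Finset (Fin n)) : k :=
  ∏ j ∈ T with j < i, sg k (e i * e j)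

/-- The operator of left multiplication by the `i`-th generator. -/
def create (i : Fin n) : Module.End k (Finset (Fin n) → k) where
  toFun f S := if i ∈ S then createSign k e i (S.erase i) * f (S.erase i) else 0
  map_add' f g := by
    funext S
    simp only [Pi.add_apply]
    split_ifs
    · ring
    · simp
  map_smul' c f := by
    funext S
    simp only [Pi.smul_apply, smul_eq_mul, RingHom.id_apply]
    split_ifs
    · ring
    · simp

theorem create_apply (i : Fin n) (f : Finset (Fin n) → k) (S : Finset (Fin n)) :
    create k e i f S = if i ∈ S then createSign k e i (S.erase i) * f (S.erase i) else 0 := rfl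

theorem createSign_erase_of_lt {i j : Fin n} {T : Finset (Fin n)} (hj : j ∈ T) (h : j < i) :
    createSign k e i T = sg k (e i * e j) * createSign k e i (T.erase j) := by
  rw [createSign, createSign, Finset.filter_erase,
    Finset.mul_prod_erase _ (fun j => sg k (e i * e j)) (Finset.mem_filter.2 ⟨hj, h⟩)]

theorem createSign_erase_of_not_lt {i j : Fin n} {T : Finset (Fin n)} (h : ¬ j < i) :
    createSign k e i (T.erase j) = createSign k e i T := by
  rw [createSign, createSign, Finset.filter_erase, Finset.erase_eq_of_notMem]
  simp [h]

theorem create_mul_self (i : Fin n) : create k e i * create k e i = 0 := by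
  refine LinearMap.ext fun f => funext fun S => ?_
  simp [create_apply]

theorem create_comm (i j : Fin n) :
    create k e i * create k e j = sg k (e i * e j) • (create k e j * create k e i) := by
  have key : ∀ i j : Fin n, i < j →
      create k e j * create k e i = sg k (e j * e i) • (create k e i * create k e j) := by
    intro i j hij
    refine LinearMap.ext fun f => funext fun S => ?_
    simp only [Module.End.mul_apply, LinearMap.smul_apply, Pi.smul_apply, smul_eq_mul,
      create_apply, Finset.mem_erase, hij.ne, hij.ne', ne_eq, not_false_eq_true, true_and]
    by_cases hi : i ∈ S
    · by_cases hj : j ∈ S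
      · rw [if_pos hj, if_pos hi, if_pos hi, if_pos hj,
          createSign_erase_of_lt k e (T := S.erase j) (Finset.mem_erase.2 ⟨hij.ne, hi⟩) hij,
          Finset.erase_right_comm (a := i),
          createSign_erase_of_not_lt k e (i := i) hij.not_gt (T := S.erase i) |>.symm,
          Finset.erase_right_comm (a := i) (b := j)]
        ring
      · simp [hj]
    · simp [hi]
  rcases lt_trichotomy i j with h | rfl | h
  · rw [key i j h, smul_smul, mul_comm (e j), sg_mul_self, one_smul]
  · rw [create_mul_self, smul_zero]
  · exact key j i h

theorem prod_create_apply (w : List (Fin n)) (hw : w.Pairwise (· < ·)) :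
    (w.map (create k e)).prod (Pi.single ∅ 1) w.toFinset = 1 := by
  induction w with
  | nil => simp
  | cons i w ih =>
    rw [List.pairwise_cons] at hw
    have hi : i ∉ w.toFinset := fun h => lt_irrefl i (hw.1 i (List.mem_toFinset.1 h))
    rw [List.map_cons, List.prod_cons, Module.End.mul_apply, create_apply, List.toFinset_cons,
      if_pos (Finset.mem_insert_self _ _), Finset.erase_insert hi, ih hw.2, mul_one, createSign,
      Finset.filter_eq_empty_iff.2, Finset.prod_empty]
    intro j hj
    exact (hw.1 j (List.mem_toFinset.1 hj)).not_gt

/-- There is a graded commutative algebra with generators of any given degrees, in which the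
product of all the generators spans a free direct summand. -/
theorem exists_isGradedNil : ∃ (M : ℤ → Module.End k (Finset (Fin n) → k) → Prop)
    (ε : Fin n → Module.End k (Finset (Fin n) → k))
    (φ : Module.End k (Finset (Fin n) → k) →ₗ[k] k),
    IsGradedNil k M ∧ (∀ i, M (e i) (ε i)) ∧ φ (List.ofFn ε).prod = 1 := by
  -- The functional applies an operator to the basis vector of the empty set and reads the
  -- coordinate of the full set.
  refine ⟨IsMonomial k e (create k e), create k e,
    LinearMap.proj (List.finRange n).toFinset ∘ₗ LinearMap.applyₗ (Pi.single ∅ 1),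
    isGradedNil_isMonomial (create_comm k e) (create_mul_self k e), IsMonomial.gen, ?_⟩
  rw [List.ofFn_eq_map]
  exact prod_create_apply k e _ (List.pairwise_lt_finRange n)

end

/-! ### The brackets as multilinear maps on `H` -/

section

variable {k L : Type*} [CommRing k] [AddCommGroup L] [Module k L] {A : DGLieAlgebra k L}
  {η : L →ₗ[k] L}

theorem DGLieAlgebra.IsSplitting.sub_comm_mem_H (hη : A.IsSplitting η) (v : L) :
    (LinearMap.id - A.comm η : L →ₗ[k] L) v ∈ A.H η := by
  rw [DGLieAlgebra.H, LinearMap.mem_ker]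
  simp only [DGLieAlgebra.comm, LinearMap.sub_apply, LinearMap.id_apply, LinearMap.add_apply,
    LinearMap.comp_apply, map_sub, map_add, A.d_d, hη.eta_eta, hη.eta_d_eta, map_zero, add_zero,
    zero_add, hη.d_eta_d, sub_self]

theorem DGLieAlgebra.sub_comm_of_mem_H {v : L} (hv : v ∈ A.H η) :
    (LinearMap.id - A.comm η : L →ₗ[k] L) v = v := by
  rw [LinearMap.sub_apply, LinearMap.mem_ker.1 hv, sub_zero, LinearMap.id_apply]

theorem DGLieAlgebra.IsSplitting.d_of_mem_H (hη : A.IsSplitting η) {v : L} (hv : v ∈ A.H η) :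
    A.d v = 0 := by
  have h : A.d (η v) + η (A.d v) = 0 := LinearMap.mem_ker.1 hv
  have h2 := congrArg A.d h
  rwa [map_add, A.d_d, zero_add, hη.d_eta_d, map_zero] at h2

theorem DGLieAlgebra.IsSplitting.sub_comm_mem_gr (hη : A.IsSplitting η) {i : ℤ} {v : L}
    (hv : v ∈ A.gr i) : (LinearMap.id - A.comm η : L →ₗ[k] L) v ∈ A.gr i := by
  have h1 := A.d_mem _ _ (hη.eta_mem _ _ hv)
  have h2 := hη.eta_mem _ _ (A.d_mem _ _ hv)
  rw [sub_add_cancel] at h1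
  rw [add_sub_cancel_right] at h2
  exact Submodule.sub_mem _ hv (Submodule.add_mem _ h1 h2)

/-- Independence is inherited from `L`; spanning follows by applying the degree 0 projection `1 -
[d,η]` onto `H` to a decomposition in `L`. -/
theorem DGLieAlgebra.IsSplitting.isInternal_grH (hη : A.IsSplitting η) :
    DirectSum.IsInternal (A.grH η) := by
  have hA := (DirectSum.isInternal_submodule_iff_iSupIndep_and_iSup_eq_top _).1 A.isInternal
  refine (DirectSum.isInternal_submodule_iff_iSupIndep_and_iSup_eq_top _).2 ⟨?_, ?_⟩
  · rw [iSupIndep_def]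
    intro i
    rw [Submodule.disjoint_def]
    intro x hx hx'
    have h := Submodule.disjoint_def.1 (hA.1 i) x hx
    refine Subtype.ext (h ?_)
    have h2 : (⨆ j, ⨆ (_ : j ≠ i), A.grH η j) ≤
        (⨆ j, ⨆ (_ : j ≠ i), A.gr j).comap (A.H η).subtype :=
      iSup₂_le fun j hj => Submodule.comap_mono (le_iSup₂_of_le j hj le_rfl)
    exact h2 hx'
  · rw [eq_top_iff]
    intro x _
    let π : L →ₗ[k] A.H η := (LinearMap.id - A.comm η : L →ₗ[k] L).codRestrict (A.H η) hη.sub_comm_mem_H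
    have hx : x = π x := Subtype.ext (DGLieAlgebra.sub_comm_of_mem_H x.2).symm
    have h : (⨆ i, A.gr i) ≤ (⨆ i, A.grH η i).comap π := by
      refine iSup_le fun i v hv => ?_
      exact Submodule.mem_iSup_of_mem i (hη.sub_comm_mem_gr hv)
    rw [hx]
    exact h (hA.2 ▸ Submodule.mem_top)

theorem treeDegree_decorate (hη : A.IsSplitting η) (φ : BinaryTree Unit) (hφ : φ ≠ .nil) :
    treeDegree (decorate hη.projBracket hη.g φ) = 2 - (φ.numLeaves : ℤ) := by
  cases φ with
  | nil => exact absurd rfl hφ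
  | node u l r =>
    rw [decorate, treeDegree, treeDegree_map_g, treeDegree_map_g, BinaryTree.numLeaves,
      l.numLeaves_eq_numNodes_succ, r.numLeaves_eq_numNodes_succ]
    simp only [DGLieAlgebra.IsSplitting.projBracket]
    push_cast
    ring

theorem treeEval_decorate_mem_H (hη : A.IsSplitting η) (φ : BinaryTree Unit) (hφ : φ ≠ .nil)
    (deg : Fin (decorate hη.projBracket hη.g φ).numLeaves → ℤ)
    (a : Fin (decorate hη.projBracket hη.g φ).numLeaves → L) :
    treeEval (decorate hη.projBracket hη.g φ) deg a ∈ A.H η := by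
  cases φ with
  | nil => exact absurd rfl hφ
  | node u l r =>
    simp only [decorate, treeEval]
    rw [negOnePow_smul (k := k)]
    exact Submodule.smul_mem _ _ (hη.sub_comm_mem_H _)

theorem Ot.ne_nil {n : ℕ} (hn : 2 ≤ n) (φ : Ot n) : φ.1 ≠ .nil := by
  intro h
  have := φ.2
  rw [h] at this
  simp only [BinaryTree.numLeaves] at this
  omega

/-- The degrees enter only through signs, so once `deg` is fixed the formula is multilinear on all
of `L`. -/
theorem exists_multilinear_treeEval {gr : ℤ → Submodule k L}
    (Ψ : BinaryTree (HomogeneousBilin gr)) (deg : Fin Ψ.numLeaves → ℤ) :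
    ∃ m : MultilinearMap k (fun _ : Fin Ψ.numLeaves => L) L, ∀ a, m a = treeEval Ψ deg a := by
  induction Ψ with
  | nil => exact ⟨MultilinearMap.ofSubsingleton k L L (0 : Fin 1) LinearMap.id, fun a => rfl⟩
  | node b l r hl hr =>
    obtain ⟨m₁, h₁⟩ := hl fun i => deg (Fin.castAdd r.numLeaves i)
    obtain ⟨m₂, h₂⟩ := hr fun i => deg (Fin.natAdd l.numLeaves i)
    refine ⟨sg k (treeDegree r * ∑ i : Fin l.numLeaves, deg (Fin.castAdd r.numLeaves i)) •
      ((TensorProduct.lift b.map).compMultilinearMap (m₁.domCoprod m₂)).domDomCongr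
        finSumFinEquiv, fun a => ?_⟩
    rw [treeEval, negOnePow_smul (k := k), ← h₁, ← h₂]
    rfl

variable [Invertible (2 : k)]

theorem treeBracket_mem_H (hη : A.IsSplitting η) {n : ℕ} (hn : 2 ≤ n) (deg : Fin n → ℤ)
    (a : Fin n → L) : hη.treeBracket n deg a ∈ A.H η := by
  refine Submodule.smul_mem _ _ (Submodule.sum_mem _ fun φ _ => ?_)
  rw [unit_smul k]
  refine Submodule.smul_mem _ _ (Submodule.sum_mem _ fun σ _ => ?_)
  rw [unit_smul k]
  exact Submodule.smul_mem _ _ (treeEval_decorate_mem_H hη φ.1 (φ.ne_nil hn) _ _)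

theorem treeBracket_mem_gr (hη : A.IsSplitting η) {n : ℕ} (hn : 2 ≤ n) (deg : Fin n → ℤ)
    (a : Fin n → L) (ha : ∀ i, a i ∈ A.gr (deg i)) :
    hη.treeBracket n deg a ∈ A.gr (∑ i, deg i + 2 - n) := by
  refine Submodule.smul_mem _ _ (Submodule.sum_mem _ fun φ _ => ?_)
  rw [unit_smul k]
  refine Submodule.smul_mem _ _ (Submodule.sum_mem _ fun σ _ => ?_)
  rw [unit_smul k]
  refine Submodule.smul_mem _ _ ?_
  have h := treeEval_mem (decorate hη.projBracket hη.g φ.1)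
    (fun i => deg (σ (Fin.cast ((numLeaves_decorate _ _ φ.1).trans φ.2) i)))
    (fun i => a (σ (Fin.cast ((numLeaves_decorate _ _ φ.1).trans φ.2) i))) fun i => ha _
  rw [treeDegree_decorate hη φ.1 (φ.ne_nil hn)] at h
  have hs : ∑ i, deg (σ (Fin.cast ((numLeaves_decorate hη.projBracket hη.g φ.1).trans φ.2) i)) =
      ∑ i, deg i :=
    Equiv.sum_comp ((finCongr ((numLeaves_decorate hη.projBracket hη.g φ.1).trans φ.2)).trans σ) deg
  have hn' : (φ.1.numLeaves : ℤ) = n := congrArg Nat.cast φ.2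
  rwa [hs, hn', ← add_sub_assoc] at h

theorem exists_multilinear_treeBracket (hη : A.IsSplitting η) (n : ℕ) (deg : Fin n → ℤ) :
    ∃ m : MultilinearMap k (fun _ : Fin n => L) L, ∀ a, m a = hη.treeBracket n deg a := by
  choose m hm using fun (φ : Ot n) (σ : Equiv.Perm (Fin n)) =>
    exists_multilinear_treeEval (decorate hη.projBracket hη.g φ.1)
      (fun i => deg (σ (Fin.cast ((numLeaves_decorate _ _ φ.1).trans φ.2) i)))
  refine ⟨(-⅟(2 : k)) ^ (n - 1) • ∑ φ : Ot n, ((treeSign φ.1 : ℤ) : k) •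
    ∑ σ : Equiv.Perm (Fin n), ((koszulChi σ deg : ℤ) : k) • (m φ σ).domDomCongr
      ((finCongr ((numLeaves_decorate hη.projBracket hη.g φ.1).trans φ.2)).trans σ), fun a => ?_⟩
  rw [DGLieAlgebra.IsSplitting.treeBracket]
  simp only [smul_apply, sum_apply, MultilinearMap.domDomCongr_apply,
    unit_smul k, hm]
  rfl

/-- The tree formula is a different multilinear map in each multidegree. These are glued along the
decomposition of `L` and projected onto `H`, where the projection is the identity on the values in
question. -/
theorem exists_brackets (hη : A.IsSplitting η) :
    ∃ μ : (n : ℕ) → MultilinearMap k (fun _ : Fin n => A.H η) (A.H η), μ 0 = 0 ∧ μ 1 = 0 ∧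
      ∀ n : ℕ, 2 ≤ n → ∀ (deg : Fin n → ℤ) (a : Fin n → A.H η),
        (∀ i, a i ∈ A.grH η (deg i)) →
          (μ n a : L) = hη.treeBracket n deg (fun i => (a i : L)) := by
  choose m hm using exists_multilinear_treeBracket (k := k) hη
  let D := (LinearEquiv.ofBijective (DirectSum.coeLinearMap A.gr) A.isInternal).symm
  let π : L →ₗ[k] A.H η := (LinearMap.id - A.comm η : L →ₗ[k] L).codRestrict (A.H η) hη.sub_comm_mem_H
  let ν (n : ℕ) : MultilinearMap k (fun _ : Fin n => L) L :=
    (MultilinearMap.fromDirectSumEquiv fun deg : Fin n → ℤ =>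
      (m n deg).compLinearMap fun i => (A.gr (deg i)).subtype).compLinearMap
        fun _ => D.toLinearMap
  refine ⟨fun n => if 2 ≤ n then
    π.compMultilinearMap ((ν n).compLinearMap fun _ => (A.H η).subtype) else 0,
    if_neg (by norm_num), if_neg (by norm_num), fun n hn deg a ha => ?_⟩
  have hν : ν n (fun i => (a i : L)) = hη.treeBracket n deg (fun i => (a i : L)) := by
    have ha' : ∀ i, (a i : L) ∈ A.gr (deg i) := ha
    have hD : (fun i => D.toLinearMap (a i : L)) =
        fun i => DirectSum.lof k ℤ (fun i => A.gr i) (deg i) ⟨a i, ha' i⟩ :=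
      funext fun i => coeLinearMap_symm_apply A.isInternal (ha' i)
    rw [MultilinearMap.compLinearMap_apply, hD]
    exact (MultilinearMap.fromDirectSumEquiv_lof (M := fun _ i => A.gr i)
      (fun deg : Fin n → ℤ => (m n deg).compLinearMap fun i => (A.gr (deg i)).subtype) deg
      fun i => ⟨(a i : L), ha' i⟩).trans (hm _ _ _)
  simp only [if_pos hn]
  change (LinearMap.id - A.comm η : L →ₗ[k] L) (ν n fun i => (a i : L)) = _
  rw [hν, DGLieAlgebra.sub_comm_of_mem_H (treeBracket_mem_H hη hn _ _)]

end

/-! ### Shuffles -/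

theorem mem_shuffles {p n : ℕ} {σ : Equiv.Perm (Fin n)} : σ ∈ shuffles p n ↔
    (∀ i j : Fin n, i < j → j.val < p → σ i < σ j) ∧
    (∀ i j : Fin n, p ≤ i.val → i < j → σ i < σ j) := by
  simp [shuffles]

/-- A strictly increasing map is determined by its range, and the range of the second block is the
complement of that of the first. -/
theorem shuffles_ext {p n : ℕ} (hp : p ≤ n) {σ τ : Equiv.Perm (Fin n)} (hσ : σ ∈ shuffles p n)
    (hτ : τ ∈ shuffles p n)
    (h : Set.range (fun i : Fin p => σ ⟨i, by omega⟩) =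
      Set.range (fun i : Fin p => τ ⟨i, by omega⟩)) : σ = τ := by
  rw [mem_shuffles] at hσ hτ
  have h1 : (fun i : Fin p => σ ⟨i, by omega⟩) = fun i : Fin p => τ ⟨i, by omega⟩ := by
    refine (StrictMono.range_inj ?_ ?_).1 h
    · exact fun i j hij => hσ.1 _ _ hij j.2
    · exact fun i j hij => hτ.1 _ _ hij j.2
  have hc : ∀ ρ : Equiv.Perm (Fin n), Set.range (fun j : Fin (n - p) => ρ ⟨p + j, by omega⟩) =
      (Set.range (fun i : Fin p => ρ ⟨i, by omega⟩))ᶜ := by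
    intro ρ
    ext x
    obtain ⟨y, rfl⟩ := ρ.surjective x
    simp only [Set.mem_range, Set.mem_compl_iff, ρ.apply_eq_iff_eq]
    constructor
    · rintro ⟨j, rfl⟩ ⟨i, hi⟩
      have := congrArg Fin.val hi
      simp only at this
      omega
    · intro hy
      have : p ≤ y.val := by
        by_contra hlt
        exact hy ⟨⟨y, by omega⟩, rfl⟩
      exact ⟨⟨y - p, by omega⟩, Fin.ext (by simp only; omega)⟩
  have h2 : (fun j : Fin (n - p) => σ ⟨p + j, by omega⟩) =
      fun j : Fin (n - p) => τ ⟨p + j, by omega⟩ := by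
    refine (StrictMono.range_inj ?_ ?_).1 ?_
    · intro i j hij
      refine hσ.2 _ _ (Nat.le_add_right _ _) ?_
      rw [Fin.lt_def] at hij ⊢
      simpa using hij
    · intro i j hij
      refine hτ.2 _ _ (Nat.le_add_right _ _) ?_
      rw [Fin.lt_def] at hij ⊢
      simpa using hij
    · rw [hc, hc, h]
  refine Equiv.ext fun i => ?_
  by_cases hi : i.val < p
  · exact congrFun h1 ⟨i, hi⟩
  · have := congrFun h2 ⟨i - p, by omega⟩
    have hi' : p + (i.val - p) = i.val := by omega
    simpa only [hi'] using this

theorem exists_shuffle {p n : ℕ} (hp : p ≤ n) {f : Fin p → Fin n} (hf : Function.Injective f) :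
    ∃ σ ∈ shuffles p n, ∃ π : Equiv.Perm (Fin p), ∀ i, f i = σ ⟨π i, by omega⟩ := by
  classical
  let S : Finset (Fin n) := Finset.univ.image f
  have hS : S.card = p := by
    rw [Finset.card_image_of_injective _ hf, Finset.card_univ, Fintype.card_fin]
  have hS' : Sᶜ.card = n - p := by
    rw [Finset.card_compl, hS, Fintype.card_fin]
  let c : Fin n ≃ Fin (p + (n - p)) := finCongr (by omega)
  let σ : Equiv.Perm (Fin n) := c.trans (finSumFinEquiv.symm.trans (finSumEquivOfFinset hS hS'))
  have h1 : ∀ (i : ℕ) (hi : i < p), σ ⟨i, by omega⟩ = S.orderEmbOfFin hS ⟨i, hi⟩ := by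
    intro i hi
    have : c ⟨i, by omega⟩ = Fin.castAdd (n - p) ⟨i, hi⟩ := rfl
    simp only [σ, Equiv.trans_apply, this, finSumFinEquiv_symm_apply_castAdd,
      finSumEquivOfFinset_inl]
  have h2 : ∀ (j : ℕ) (hj : j < n) (hj' : p ≤ j),
      σ ⟨j, hj⟩ = Sᶜ.orderEmbOfFin hS' ⟨j - p, by omega⟩ := by
    intro j hj hj'
    have : c ⟨j, hj⟩ = Fin.natAdd p ⟨j - p, by omega⟩ := Fin.ext (by simp [c]; omega)
    simp only [σ, Equiv.trans_apply, this, finSumFinEquiv_symm_apply_natAdd,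
      finSumEquivOfFinset_inr]
  refine ⟨σ, mem_shuffles.2 ⟨fun i j hij hj => ?_, fun i j hi hij => ?_⟩, ?_⟩
  · rw [h1 i (by omega), h1 j hj]
    exact (S.orderEmbOfFin hS).strictMono hij
  · rw [h2 i i.2 hi, h2 j j.2 (by omega)]
    refine (Sᶜ.orderEmbOfFin hS').strictMono ?_
    rw [Fin.lt_def] at hij ⊢
    simp only
    omega
  · have hmem : ∀ i, f i ∈ S := fun i => Finset.mem_image_of_mem f (Finset.mem_univ i)
    let π : Fin p → Fin p := fun i => (S.orderIsoOfFin hS).symm ⟨f i, hmem i⟩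
    have hπ : Function.Injective π := fun i j hij =>
      hf (congrArg Subtype.val ((S.orderIsoOfFin hS).symm.injective hij))
    refine ⟨Equiv.ofBijective π (Finite.injective_iff_bijective.1 hπ), fun i => ?_⟩
    rw [h1 _ (Fin.is_lt _)]
    simp [π, ← Finset.coe_orderIsoOfFin_apply]

/-- An injective word is uniquely a shuffle, fixing its set of letters, together with a permutation
of its positions. -/
theorem sum_shuffles_perm {V : Type*} [AddCommMonoid V] {p n : ℕ} (hp : p ≤ n)
    (G : (Fin p → Fin n) → V) (hG : ∀ f, ¬ Function.Injective f → G f = 0) :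
    ∑ f, G f = ∑ σ ∈ shuffles p n, ∑ π : Equiv.Perm (Fin p), G fun i => σ ⟨π i, by omega⟩ := by
  rw [← Finset.sum_product']
  symm
  refine Finset.sum_of_injOn (fun s i => s.1 ⟨s.2 i, by omega⟩) ?_ (fun _ _ => Finset.mem_univ _)
    ?_ fun _ _ => rfl
  · rintro ⟨σ, π⟩ h ⟨τ, ρ⟩ h' heq
    simp only [Finset.coe_product, Set.mem_prod, Finset.mem_coe] at h h'
    have hr : ∀ (σ : Equiv.Perm (Fin n)) (π : Equiv.Perm (Fin p)),
        Set.range (fun i : Fin p => σ ⟨π i, by omega⟩) =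
          Set.range (fun i : Fin p => σ ⟨i, by omega⟩) := fun σ π =>
      π.surjective.range_comp fun i : Fin p => σ ⟨i, by omega⟩
    obtain rfl : σ = τ := shuffles_ext hp h.1 h'.1 (by
      rw [← hr σ π, ← hr τ ρ]
      exact congrArg Set.range heq)
    refine Prod.ext rfl (Equiv.ext fun i => ?_)
    have := σ.injective (congrFun heq i)
    exact Fin.ext (congrArg (fun x : Fin n => x.val) this)
  · intro f _ hf
    refine hG f fun hinj => hf ?_
    obtain ⟨σ, hσ, π, h⟩ := exists_shuffle hp hinj
    exact ⟨(σ, π), by simpa using hσ, (funext h).symm⟩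

/-! ### Coefficient extraction and first order expansion -/

section

variable {k L R : Type*} [CommRing k] [AddCommGroup L] [Module k L] [Ring R] [Algebra k R]
  {M : ℤ → R → Prop} {A : DGLieAlgebra k L} {η : L →ₗ[k] L}

theorem koszulProd_eq_smul_prod {J : Type*} (deg : J → ℤ) (r : J → R) (w : List J) :
    ∃ s : ℤ, koszulProd k deg r w = sg k s • (w.map r).prod := by
  induction w with
  | nil => exact ⟨0, by simp [koszulProd, sg_zero]⟩
  | cons x w ih =>
    obtain ⟨s, hs⟩ := ih
    refine ⟨deg x * w.length + s, ?_⟩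
    rw [koszulProd, hs, mul_smul_comm, smul_smul, ← sg_add, List.map_cons, List.prod_cons]

theorem eq_zero_of_tmul_eq_zero (φ : R →ₗ[k] k) {r : R} {v : L} {s : ℤ} (hr : φ r = sg k s)
    (h : r ⊗ₜ[k] v = 0) : v = 0 := by
  have h1 := congrArg (TensorProduct.lid k L ∘ φ.rTensor L) h
  simp only [Function.comp_apply, LinearMap.rTensor_tmul, TensorProduct.lid_tmul, hr,
    map_zero] at h1
  rw [← one_smul k v, ← sg_mul_self s, mul_smul, h1, smul_zero]

theorem sum_tmul_mem_totalDegree {J : Type*} [Fintype J] {deg : J → ℤ} {r : J → R} {b : J → L}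
    (hr : ∀ j, M (1 - deg j) (r j)) (hb : ∀ j, b j ∈ A.gr (deg j)) :
    ∑ j, r j ⊗ₜ[k] b j ∈ totalDegree M A.gr 1 :=
  Submodule.sum_mem _ fun j _ => tmul_mem_totalDegree (hr j) (hb j) (sub_add_cancel _ _)

theorem rTensor_mulLeft_mem (hM : IsGradedNil k M) {m n c : ℤ} {ζ : R} (hζ : M c ζ)
    (h : c + m = n) : ∀ x ∈ totalDegree M A.gr m,
      (LinearMap.mulLeft k ζ).rTensor L x ∈ totalDegree M A.gr n := by
  refine totalDegree_induction hM ?_ (by simp) ?_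
  · intro i r u hr hu
    exact tmul_mem_totalDegree (hM.mul hζ hr) hu (by omega)
  · intro x _ y _ h1 h2
    rw [map_add]
    exact Submodule.add_mem _ h1 h2

theorem tensorBracket_mulLeft_mulLeft (hM : IsGradedNil k M) {c m n : ℤ} {ζ : R} (hζ : M c ζ) :
    ∀ x ∈ totalDegree M A.gr m, ∀ y ∈ totalDegree M A.gr n,
      tensorBracket R A ((LinearMap.mulLeft k ζ).rTensor L x)
        ((LinearMap.mulLeft k ζ).rTensor L y) = 0 := by
  refine totalDegree_induction hM ?_ (by simp) ?_
  · intro i r u hr hu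
    refine totalDegree_induction hM ?_ (by simp) ?_
    · intro j s v hs hv
      rw [LinearMap.rTensor_tmul, LinearMap.rTensor_tmul, tensorBracket_tmul hu]
      simp only [LinearMap.mulLeft_apply]
      rw [mul_assoc, ← mul_assoc r, hM.comm hr hζ, smul_mul_assoc, mul_smul_comm, mul_assoc ζ r s,
        ← mul_assoc, hM.sq hζ, zero_mul, smul_zero, TensorProduct.zero_tmul, smul_zero]
    · intro x _ y _ h1 h2
      simp only [map_add, h1, h2, add_zero]
  · intro x _ y _ h1 h2 z hz
    simp only [map_add, LinearMap.add_apply, h1 z hz, h2 z hz, add_zero]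

variable [Invertible (2 : k)]

/-- The tree brackets are graded antisymmetric. -/
theorem treeBracket_antisymm (hη : A.IsSplitting η) {n : ℕ} (hn : 2 ≤ n) {deg : Fin n → ℤ}
    {a : Fin n → L} (ha : ∀ i, a i ∈ A.gr (deg i)) (σ : Equiv.Perm (Fin n)) :
    hη.treeBracket n (fun i => deg (σ i)) (fun i => a (σ i)) =
      koszulChi σ deg • hη.treeBracket n deg a := by
  obtain ⟨m, rfl⟩ := Nat.exists_eq_add_of_le' hn
  obtain ⟨M, ε, φ, hM, hε, hφ⟩ := exists_isGradedNil k fun i => 1 - deg i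
  have h1 := F_eq_treeBracket (b := a) hM hη hε ha
  have h2 := F_eq_treeBracket (deg := fun i => deg (σ i)) (r := fun i => ε (σ i))
    (b := fun i => a (σ i)) hM hη (fun j => hε (σ j)) (fun j => ha (σ j))
  -- The generic element does not see the labelling, so both brackets are coefficients of the same
  -- `F`.
  rw [Equiv.sum_comp σ fun j => ε j ⊗ₜ[k] a j, h1] at h2
  have h3 : koszulProd k (fun i => deg (σ i)) (fun i => ε (σ i)) (List.finRange (m + 2)) =
      ((koszulChi σ deg : ℤ) : k) • koszulProd k deg ε (List.finRange (m + 2)) := by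
    rw [← koszulProd_perm hM hε, List.ofFn_eq_map, koszulProd_map]
    rfl
  obtain ⟨s, hs⟩ := koszulProd_eq_smul_prod (k := k) deg ε (List.finRange (m + 2))
  rw [← List.ofFn_eq_map] at hs
  have hφ' : φ (koszulProd k deg ε (List.finRange (m + 2))) = sg k s := by
    rw [hs, map_smul, hφ, smul_eq_mul, mul_one]
  rw [h3, TensorProduct.smul_tmul, ← sub_eq_zero, ← TensorProduct.tmul_sub] at h2
  have h4 := sub_eq_zero.1 (eq_zero_of_tmul_eq_zero φ hφ' h2)
  rw [h4, unit_smul k, smul_smul, ← Int.cast_mul, Int.units_coe_mul_self, Int.cast_one, one_smul]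

theorem F_eq_sum_shuffles (hM : IsGradedNil k M) (hη : A.IsSplitting η) {m n : ℕ}
    (hn : m + 2 ≤ n) {deg : Fin n → ℤ} {r : Fin n → R} {a : Fin n → L}
    (hr : ∀ j, M (1 - deg j) (r j)) (ha : ∀ j, a j ∈ A.gr (deg j)) :
    (tensorOddLie hM hη).F (∑ j, r j ⊗ₜ[k] a j) (m + 1) = ∑ σ ∈ shuffles (m + 2) n,
      koszulProd k deg r (List.ofFn fun i : Fin (m + 2) => σ ⟨i, by omega⟩) ⊗ₜ[k]
        hη.treeBracket (m + 2) (fun i => deg (σ ⟨i, by omega⟩)) (fun i => a (σ ⟨i, by omega⟩)) := by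
  rw [F_expansion hM hη ha, sum_shuffles_perm hn]
  · refine Finset.sum_congr rfl fun σ _ => ?_
    exact sum_perm_koszulProd_tmul_treeSum hM hη hr fun i : Fin (m + 2) => σ ⟨i, by omega⟩
  · intro f hf
    rw [Function.not_injective_iff] at hf
    obtain ⟨i, j, hij, hne⟩ := hf
    rw [koszulProd_ofFn_eq_zero hM hr hne, TensorProduct.zero_tmul]
    rw [hij]
    exact hM.sq (hr _)

theorem F_add_mulLeft (hM : IsGradedNil k M) (hη : A.IsSplitting η) {ζ : R} (hζ : M (-1) ζ)
    {x y : R ⊗[k] L} (hx : x ∈ totalDegree M A.gr 1) (hy : y ∈ totalDegree M A.gr 2) (m : ℕ) :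
    (tensorOddLie hM hη).F (x + (LinearMap.mulLeft k ζ).rTensor L y) m =
      (tensorOddLie hM hη).F x m +
        (LinearMap.mulLeft k ζ).rTensor L ((tensorOddLie hM hη).DF x y m) := by
  have hcomm : ∀ (f : L →ₗ[k] L) (v : R ⊗[k] L), f.lTensor R ((LinearMap.mulLeft k ζ).rTensor L v) =
      (LinearMap.mulLeft k ζ).rTensor L (f.lTensor R v) := fun f v => by
    rw [← LinearMap.comp_apply, ← LinearMap.comp_apply, LinearMap.lTensor_comp_rTensor,
      LinearMap.rTensor_comp_lTensor]
  refine OddLie.F_add _ hx (hcomm η) ?_ (tensorBracket_rTensor_mulLeft ζ)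
    (fun j => rTensor_mulLeft_mem hM hζ (by norm_num) _ (tensorOddLie_D_mem hM hη hx hy j))
    (fun i j => tensorBracket_mulLeft_mulLeft hM hζ _ (tensorOddLie_D_mem hM hη hx hy i) _
      (tensorOddLie_D_mem hM hη hx hy j)) m
  rw [tensorOddLie_p]
  exact hcomm _

/-- The direction `s ⊗ b` is adjoined as an extra letter `none` with coefficient `ζ s`, of degree `1
- c`. Expanding `F` over the enlarged alphabet, the words containing `none` form the derivative. -/
theorem mulLeft_DF_tmul (hM : IsGradedNil k M) (hη : A.IsSplitting η) {p q n : ℕ} (hpq : p + q = n)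
    {j : ℕ} (hq : q = j + 1)
    {deg : Fin n → ℤ} {r : Fin n → R} {a : Fin n → L} (hr : ∀ j, M (1 - deg j) (r j))
    (ha : ∀ j, a j ∈ A.gr (deg j)) {ζ : R} (hζ : M (-1) ζ) {c : ℤ} {s : R} {b : L}
    (hs : M (2 - c) s) (hb : b ∈ A.gr c) (σ : Equiv.Perm (Fin n))
    (hsr : ∀ i : Fin n, i.val < p → s * r (σ i) = 0) :
    (LinearMap.mulLeft k ζ).rTensor L
        ((tensorOddLie hM hη).DF (∑ j, r j ⊗ₜ[k] a j) (s ⊗ₜ[k] b) q) =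
      (sg k (c * q) • (ζ * s *
        koszulProd k deg r (List.ofFn fun j : Fin q => σ ⟨p + j, by omega⟩))) ⊗ₜ[k]
        hη.treeBracket (q + 1)
          (Fin.cons c fun j : Fin q => deg (σ ⟨p + j, by omega⟩) : Fin (q + 1) → ℤ)
          (Fin.cons b fun j : Fin q => a (σ ⟨p + j, by omega⟩) : Fin (q + 1) → L) := by
  subst hq
  let deg' : Option (Fin n) → ℤ := fun o => o.elim c deg
  let r' : Option (Fin n) → R := fun o => o.elim (ζ * s) r
  let b' : Option (Fin n) → L := fun o => o.elim b a
  have hr' : ∀ o, M (1 - deg' o) (r' o) := by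
    rintro (_ | i)
    · have := hM.mul hζ hs
      rwa [show -1 + (2 - c) = 1 - c by ring] at this
    · exact hr i
  have hb' : ∀ o, b' o ∈ A.gr (deg' o) := by
    rintro (_ | i)
    · exact hb
    · exact ha i
  let g : Fin (j + 1 + 1) → Option (Fin n) := Fin.cons none fun i => some (σ ⟨p + i, by omega⟩)
  let T : (Fin (j + 2) → Option (Fin n)) → R ⊗[k] L := fun f =>
    koszulProd k deg' r' (List.ofFn f) ⊗ₜ[k]
      hη.treeSum (j + 2) (fun i => deg' (f i)) (fun i => b' (f i))
  have hx := sum_tmul_mem_totalDegree hr ha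
  have hy : s ⊗ₜ[k] b ∈ totalDegree M A.gr 2 := tmul_mem_totalDegree hs hb (sub_add_cancel _ _)
  have hexp := F_add_mulLeft hM hη hζ hx hy (j + 1)
  have hsum : ∑ j, r j ⊗ₜ[k] a j + (LinearMap.mulLeft k ζ).rTensor L (s ⊗ₜ[k] b) =
      ∑ o, r' o ⊗ₜ[k] b' o := by
    rw [Fintype.sum_option, add_comm]
    rfl
  rw [hsum, F_expansion hM hη hb', F_expansion hM hη ha] at hexp
  have hg : Function.Injective g := by
    refine Fin.cons_injective_iff.2 ⟨by simp, fun i i' h => ?_⟩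
    have h1 := σ.injective (Option.some_injective _ h)
    have h2 := congrArg (fun x : Fin n => x.val) h1
    exact Fin.ext (by simpa using h2)
  -- A nonzero word containing `none` has no repetition and, since `s` kills the first `p` letters
  -- of `σ`, is a permutation of `g`.
  have hsplit : ∑ f, T f = ∑ f : Fin (j + 2) → Fin n, T (fun i => some (f i)) +
      ∑ π : Equiv.Perm (Fin (j + 2)), T (fun i => g (π i)) := by
    classical
    rw [← Finset.sum_filter_not_add_sum_filter (p := fun f : Fin (j + 2) → Option (Fin n) =>
      ∃ i, f i = none)]
    congr 1
    · symm
      refine Finset.sum_of_injOn (fun (f : Fin (j + 2) → Fin n) i => some (f i)) ?_ ?_ ?_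
        fun _ _ => rfl
      · intro f _ f' _ h
        exact funext fun i => Option.some_injective _ (congrFun h i)
      · intro f _
        simp
      · intro f hf hf'
        simp only [Finset.mem_filter, Finset.mem_univ, true_and, not_exists] at hf
        choose f₀ hf₀ using fun i => Option.ne_none_iff_exists.1 (hf i)
        exact absurd ⟨f₀, by simp, funext hf₀⟩ hf'
    · symm
      refine Finset.sum_of_injOn (fun (π : Equiv.Perm (Fin (j + 2))) i => g (π i)) ?_ ?_ ?_
        fun _ _ => rfl
      · intro π _ π' _ h
        exact Equiv.ext fun i => hg (congrFun h i)
      · intro π _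
        simp only [Finset.coe_filter, Finset.mem_univ, true_and, Set.mem_ofPred_eq]
        exact ⟨π.symm 0, by simp [g]⟩
      · intro f hf hf'
        simp only [Finset.mem_filter, Finset.mem_univ, true_and] at hf
        obtain ⟨i₀, hi₀⟩ := hf
        by_contra hT
        have hprod : ∀ i i', i ≠ i' → r' (f i) * r' (f i') ≠ 0 := fun i i' hne h =>
          hT (by simp only [T]; rw [koszulProd_ofFn_eq_zero hM hr' hne h, TensorProduct.zero_tmul])
        have hfinj : Function.Injective f := by
          intro i i' h
          by_contra hne
          exact hprod i i' hne (by rw [h]; exact hM.sq (hr' _))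
        have hlift : ∀ i, ∃ i', g i' = f i := by
          intro i
          rcases hfi : f i with _ | y
          · exact ⟨0, rfl⟩
          · obtain ⟨z, rfl⟩ := σ.surjective y
            have hz : p ≤ z.val := by
              by_contra hlt
              refine hprod i₀ i (fun h => by rw [h, hfi] at hi₀; simp at hi₀) ?_
              rw [hi₀, hfi]
              change ζ * s * r (σ z) = 0
              rw [mul_assoc, hsr z (by omega), mul_zero]
            refine ⟨Fin.succ ⟨z - p, by omega⟩, ?_⟩
            simp only [g, Fin.cons_succ]
            congr 2
            exact Fin.ext (by simp only; omega)
        choose π hπ using hlift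
        have hπinj : Function.Injective π := fun i i' h => hfinj (by rw [← hπ, ← hπ, h])
        exact hf' ⟨Equiv.ofBijective π (Finite.injective_iff_bijective.1 hπinj), by simp,
          funext hπ⟩
  have hF : ∑ f : Fin (j + 2) → Fin n, T (fun i => some (f i)) =
      ∑ f : Fin (j + 2) → Fin n, koszulProd k deg r (List.ofFn f) ⊗ₜ[k]
        hη.treeSum (j + 2) (fun i => deg (f i)) (fun i => a (f i)) := by
    refine Finset.sum_congr rfl fun f _ => ?_
    have h := koszulProd_map (k := k) (deg := deg') (r := r') some (List.ofFn f)
    rw [List.map_ofFn] at h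
    exact congrArg (· ⊗ₜ[k] _) h
  rw [hsplit, hF, add_right_inj] at hexp
  rw [← hexp, sum_perm_koszulProd_tmul_treeSum hM hη hr' g]
  have hK : koszulProd k deg' r' (List.ofFn g) = sg k (c * (j + 1 : ℕ)) • (ζ * s *
      koszulProd k deg r (List.ofFn fun i : Fin (j + 1) => σ ⟨p + i, by omega⟩)) := by
    have h := koszulProd_map (k := k) (deg := deg') (r := r') some
      (List.ofFn fun i : Fin (j + 1) => σ ⟨p + i, by omega⟩)
    rw [List.map_ofFn] at h
    rw [List.ofFn_succ, koszulProd, List.length_ofFn]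
    simp only [g, Fin.cons_zero, Fin.cons_succ]
    exact congrArg (fun v => sg k (c * (j + 1 : ℕ)) • (ζ * s * v)) h
  have hdeg : (fun i => deg' (g i)) =
      (Fin.cons c fun j : Fin (j + 1) => deg (σ ⟨p + j, by omega⟩) : Fin (j + 1 + 1) → ℤ) :=
    funext (Fin.cases rfl fun _ => rfl)
  have hbg : (fun i => b' (g i)) =
      (Fin.cons b fun j : Fin (j + 1) => a (σ ⟨p + j, by omega⟩) : Fin (j + 1 + 1) → L) :=
    funext (Fin.cases rfl fun _ => rfl)
  rw [hK, hdeg, hbg]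

end

theorem OddLie.DF_zero_right {k V : Type*} [CommRing k] [AddCommGroup V] [Module k V]
    [Invertible (2 : k)] (Q : OddLie k V) (x : V) (m : ℕ) : Q.DF x 0 m = 0 := by
  simpa using Q.DF_sum x (∅ : Finset Unit) (fun _ => 0) m

theorem koszulProd_split {k R : Type*} [CommRing k] [Ring R] [Algebra k R] {p q n : ℕ}
    (hpq : p + q = n) (deg : Fin n → ℤ) (r : Fin n → R) (σ : Fin n → Fin n) :
    koszulProd k deg r (List.ofFn σ) = sg k ((∑ i : Fin p, deg (σ ⟨i, by omega⟩)) * q) •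
      (koszulProd k deg r (List.ofFn fun i : Fin p => σ ⟨i, by omega⟩) *
        koszulProd k deg r (List.ofFn fun j : Fin q => σ ⟨p + j, by omega⟩)) := by
  subst hpq
  rw [List.ofFn_add, koszulProd_append, List.map_ofFn, List.sum_ofFn, List.length_ofFn]
  rfl

/-! ### Matching the components with the Jacobi terms -/

section

variable {k L R : Type*} [CommRing k] [Invertible (2 : k)] [AddCommGroup L] [Module k L] [Ring R]
  [Algebra k R] {M : ℤ → R → Prop} {A : DGLieAlgebra k L} {η : L →ₗ[k] L}
  {μ : (n : ℕ) → MultilinearMap k (fun _ : Fin n => A.H η) (A.H η)}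

/-- Component `p` of `F` gives the inner bracket of arity `p + 1`, and component `q` of the
derivative the outer one of arity `q + 1`. For `p = 0` or `q = 0` both sides vanish, as `μ 1 = 0`.
-/
theorem mulLeft_DF_F (hM : IsGradedNil k M) (hη : A.IsSplitting η) (hμ₁ : μ 1 = 0)
    (hμ : ∀ n : ℕ, 2 ≤ n → ∀ (deg : Fin n → ℤ) (a : Fin n → A.H η),
      (∀ i, a i ∈ A.grH η (deg i)) → (μ n a : L) = hη.treeBracket n deg (fun i => (a i : L)))
    {p q n : ℕ} (hpq : p + 1 + q = n) {deg : Fin n → ℤ} {r : Fin n → R} {a : Fin n → A.H η}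
    (hr : ∀ j, M (1 - deg j) (r j)) (ha : ∀ j, a j ∈ A.grH η (deg j)) {ζ : R} (hζ : M (-1) ζ) :
    (LinearMap.mulLeft k ζ).rTensor L ((tensorOddLie hM hη).DF (∑ j, r j ⊗ₜ[k] (a j : L))
        ((tensorOddLie hM hη).F (∑ j, r j ⊗ₜ[k] (a j : L)) p) q) =
      (ζ * koszulProd k deg r (List.finRange n)) ⊗ₜ[k]
        ((∑ σ ∈ shuffles (p + 1) n,
          (Int.negOnePow (((p + 1 : ℕ) : ℤ) * (q : ℤ)) * koszulChi σ deg) •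
          μ (q + 1) (Fin.cons (μ (p + 1) fun i : Fin (p + 1) => a (σ ⟨i, by omega⟩))
            fun j : Fin q => a (σ ⟨p + 1 + j, by omega⟩)) : A.H η) : L) := by
  rcases p with _ | m
  · rw [OddLie.F, OddLie.DF_zero_right, map_zero, Finset.sum_eq_zero, ZeroMemClass.coe_zero,
      TensorProduct.tmul_zero]
    intro σ _
    rw [hμ₁, MultilinearMap.map_coord_zero _ 0 (by simp), smul_zero]
  rcases q with _ | j
  · rw [OddLie.DF, map_zero, Finset.sum_eq_zero, ZeroMemClass.coe_zero, TensorProduct.tmul_zero]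
    intro σ _
    rw [hμ₁, zero_apply, smul_zero]
  have ha' : ∀ i, (a i : L) ∈ A.gr (deg i) := ha
  rw [F_eq_sum_shuffles (a := fun i => (a i : L)) hM hη (by omega) hr ha', OddLie.DF_sum, map_sum,
    AddSubmonoidClass.coe_finsetSum, TensorProduct.tmul_sum]
  refine Finset.sum_congr rfl fun σ _ => ?_
  have hb := treeBracket_mem_gr hη (n := m + 2) (by omega) (fun i => deg (σ ⟨i, by omega⟩))
    (fun i => (a (σ ⟨i, by omega⟩) : L)) fun i => ha' _
  have hs := koszulProd_mem hM hr (List.ofFn fun i : Fin (m + 2) => σ ⟨i, by omega⟩) (by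
    rw [List.ofFn_succ]
    exact List.cons_ne_nil _ _)
  set c : ℤ := ∑ i : Fin (m + 2), deg (σ ⟨i, by omega⟩) + 2 - (m + 2 : ℕ) with hc
  rw [List.map_ofFn, List.sum_ofFn, show ∑ i : Fin (m + 2), ((fun x => 1 - deg x) ∘
    fun i : Fin (m + 2) => σ ⟨i, by omega⟩) i = 2 - c by
      simp only [Function.comp_apply, Finset.sum_sub_distrib, hc]
      simp
      ring] at hs
  rw [mulLeft_DF_tmul (p := m + 2) hM hη (by omega) rfl hr ha' hζ hs hb σ]
  · have hin : (μ (m + 2) fun i => a (σ ⟨i, by omega⟩) : L) =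
        hη.treeBracket (m + 2) (fun i => deg (σ ⟨i, by omega⟩))
          (fun i => (a (σ ⟨i, by omega⟩) : L)) :=
      hμ _ (by omega) _ _ fun i => ha _
    rw [unit_smul k, Submodule.coe_smul, hμ (j + 1 + 1) (by omega)
      (Fin.cons c fun j : Fin (j + 1) => deg (σ ⟨m + 2 + j, by omega⟩)) _
      (Fin.cases (by
        simp only [Fin.cons_zero]
        change (μ (m + 2) fun i => a (σ ⟨i, by omega⟩) : L) ∈ A.gr c
        rw [hin]
        exact hb) fun i => ha _), ← TensorProduct.smul_tmul]
    congr 1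
    -- The inner value has degree `c`, which differs from the sum of its inputs' degrees by `2 - (m
    -- + 2)`. Moving it instead of the inputs past the `j + 1` outer letters leaves exactly the sign
    -- `(-1)^{p(l-1)}`.
    · have h1 := koszulProd_split (k := k) (p := m + 2) (q := j + 1) (by omega) deg r σ
      rw [koszulProd_perm hM hr] at h1
      rw [Units.val_mul, Int.cast_mul, mul_smul, ← mul_smul_comm ((koszulChi σ deg : ℤ) : k), h1,
        mul_smul_comm, smul_smul, mul_assoc]
      change _ = (sg k _ * _) • _
      rw [← sg_add]
      congr 1
      refine sg_congr ?_
      rw [hc]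
      push_cast
      generalize (∑ i : Fin (m + 2), deg (σ ⟨i, _⟩)) = S
      generalize (m : ℤ) = m'
      generalize (j : ℤ) = j'
      grind [Int.even_add, Int.even_sub, Int.not_even_one]
    · congr 1
      funext i
      refine Fin.cases ?_ (fun i => ?_) i
      · simp only [Fin.cons_zero]
        exact hin.symm
      · rfl
  · intro i hi
    rw [hM.comm hs (hr _), mul_koszulProd_eq_zero hM hr (hr (σ i)) (hM.sq (hr _)) _
      (List.mem_ofFn.2 ⟨⟨i, hi⟩, rfl⟩), smul_zero]

end

/-! ### The binary bracket and the generalised Jacobi identities -/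

section

variable {k L : Type*} [CommRing k] [AddCommGroup L] [Module k L]
  {A : DGLieAlgebra k L} {η : L →ₗ[k] L}

theorem DGLieAlgebra.IsSplitting.d_bracket_of_mem_H (hη : A.IsSplitting η) {i : ℤ} {u v : L}
    (hu : u ∈ A.gr i) (hu' : u ∈ A.H η) (hv' : v ∈ A.H η) : A.d (A.bracket u v) = 0 := by
  rw [A.d_bracket i u v hu, hη.d_of_mem_H hu', hη.d_of_mem_H hv', map_zero, map_zero,
    LinearMap.zero_apply, smul_zero, add_zero]

theorem DirectSum.IsInternal.linearMap_ext {k V W : Type*} [CommRing k] [AddCommGroup V]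
    [Module k V] [AddCommGroup W] [Module k W] {gr : ℤ → Submodule k V}
    (h : DirectSum.IsInternal gr) {f g : V →ₗ[k] W} (hfg : ∀ i, ∀ v ∈ gr i, f v = g v) :
    f = g := by
  have h1 : (⨆ i, gr i) ≤ LinearMap.eqLocus f g := iSup_le fun i v hv => hfg i v hv
  rw [h.submodule_iSup_eq_top] at h1
  exact LinearMap.ext fun v => h1 Submodule.mem_top

variable [Invertible (2 : k)]

/-- Read off from `½ p B(x,x)` with two generators: the diagonal terms vanish and the two equal
cross terms cancel the ½. -/
theorem treeBracket_two (hη : A.IsSplitting η) {deg : Fin 2 → ℤ} {a : Fin 2 → L}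
    (ha : ∀ i, a i ∈ A.gr (deg i)) : hη.treeBracket 2 deg a =
      (LinearMap.id - A.comm η : L →ₗ[k] L) (A.bracket (a 0) (a 1)) := by
  obtain ⟨M, ε, φ, hM, hε, hφ⟩ := exists_isGradedNil k fun i => 1 - deg i
  have h := F_eq_treeBracket (m := 0) (b := a) hM hη hε ha
  obtain ⟨s, hs⟩ := koszulProd_eq_smul_prod (k := k) deg ε (List.finRange 2)
  rw [← List.ofFn_eq_map] at hs
  have hφ' : φ (koszulProd k deg ε (List.finRange 2)) = sg k s := by
    rw [hs, map_smul, hφ, smul_eq_mul, mul_one]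
  have hm : ∀ i, ε i ⊗ₜ[k] a i ∈ totalDegree M A.gr 1 := fun i =>
    tmul_mem_totalDegree (hε i) (ha i) (sub_add_cancel _ _)
  have hdiag : ∀ i, tensorBracket _ A (ε i ⊗ₜ[k] a i) (ε i ⊗ₜ[k] a i) = 0 := fun i => by
    rw [tensorBracket_tmul (ha i), hM.sq (hε i), TensorProduct.zero_tmul, smul_zero]
  have hK : koszulProd k deg ε (List.finRange 2) = sg k (deg 0) • (ε 0 * ε 1) := by
    simp [List.finRange_succ, koszulProd, sg_zero]
  have hB : tensorBracket _ A (∑ i, ε i ⊗ₜ[k] a i) (∑ i, ε i ⊗ₜ[k] a i) =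
      (2 : k) • (koszulProd k deg ε (List.finRange 2) ⊗ₜ[k] A.bracket (a 0) (a 1)) := by
    simp only [Fin.sum_univ_two, map_add, LinearMap.add_apply, hdiag]
    rw [tensorBracket_symm hM _ (hm 1) _ (hm 0), zero_add, add_zero, ← two_smul k,
      tensorBracket_tmul (ha 0), hK, TensorProduct.smul_tmul']
  have hF : (tensorOddLie hM hη).F (∑ i, ε i ⊗ₜ[k] a i) 1 =
      koszulProd k deg ε (List.finRange 2) ⊗ₜ[k]
        (LinearMap.id - A.comm η : L →ₗ[k] L) (A.bracket (a 0) (a 1)) := by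
    rw [OddLie.F, Finset.Nat.antidiagonal_zero, Finset.sum_singleton, OddLie.t_zero, tensorOddLie_p]
    change ⅟(2 : k) • (LinearMap.id - A.comm η).lTensor _ (tensorBracket _ A _ _) = _
    rw [hB, map_smul, invOf_smul_smul, LinearMap.lTensor_tmul]
  rw [hF, ← sub_eq_zero, ← TensorProduct.tmul_sub] at h
  exact (sub_eq_zero.1 (eq_zero_of_tmul_eq_zero φ hφ' h)).symm

theorem binary_bracket_eq (hη : A.IsSplitting η)
    {μ : MultilinearMap k (fun _ : Fin 2 => A.H η) (A.H η)}
    (hμ : ∀ (deg : Fin 2 → ℤ) (a : Fin 2 → A.H η), (∀ i, a i ∈ A.grH η (deg i)) →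
      (μ a : L) = hη.treeBracket 2 deg (fun i => (a i : L))) (a b : A.H η) :
    (μ ![a, b] : L) = A.bracket a b - A.d (η (A.bracket a b)) := by
  have hup : ∀ u v w : A.H η, Function.update ![u, v] 1 w = ![u, w] := fun u v w =>
    funext (Fin.forall_fin_two.2 ⟨rfl, rfl⟩)
  let β : A.H η →ₗ[k] A.H η →ₗ[k] L := LinearMap.mk₂ k (fun a b => (μ ![a, b] : L))
    (fun a a' b => by simpa using congrArg Subtype.val (μ.cons_add ![b] a a'))
    (fun c a b => by simpa using congrArg Subtype.val (μ.cons_smul ![b] c a))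
    (fun a b b' => by
      simpa only [hup, Submodule.coe_add] using congrArg Subtype.val (μ.map_update_add ![a, 0] 1 b b'))
    (fun c a b => by
      simpa only [hup, Submodule.coe_smul] using congrArg Subtype.val (μ.map_update_smul ![a, 0] 1 c b))
  let γ : A.H η →ₗ[k] A.H η →ₗ[k] L :=
    (A.bracket.compl₁₂ (A.H η).subtype (A.H η).subtype).compr₂ (LinearMap.id - A.d ∘ₗ η)
  have h : β = γ := hη.isInternal_grH.linearMap_ext fun i u hu =>
    hη.isInternal_grH.linearMap_ext fun j v hv => by
      have h1 := hμ ![i, j] ![u, v] (Fin.forall_fin_two.2 ⟨hu, hv⟩)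
      rw [treeBracket_two hη (Fin.forall_fin_two.2 ⟨hu, hv⟩)] at h1
      refine h1.trans ?_
      have h2 := hη.d_bracket_of_mem_H (u := (u : L)) (v := v) hu u.2 v.2
      change A.bracket u v - (A.d (η (A.bracket u v)) + η (A.d (A.bracket u v))) =
        A.bracket u v - A.d (η (A.bracket u v))
      -- The bracket of closed elements is closed, so the `ηd` part of `[d,η]` contributes nothing.
      rw [h2, map_zero, add_zero]
  exact congrArg (fun f => f a b) h

theorem brackets_jacobi (hη : A.IsSplitting η)
    {μ : (n : ℕ) → MultilinearMap k (fun _ : Fin n => A.H η) (A.H η)} (hμ₀ : μ 0 = 0)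
    (hμ₁ : μ 1 = 0)
    (hμ : ∀ n : ℕ, 2 ≤ n → ∀ (deg : Fin n → ℤ) (a : Fin n → A.H η),
      (∀ i, a i ∈ A.grH η (deg i)) → (μ n a : L) = hη.treeBracket n deg (fun i => (a i : L)))
    (n : ℕ) (deg : Fin n → ℤ) (a : Fin n → A.H η) (ha : ∀ i, a i ∈ A.grH η (deg i)) :
    ∑ p : Fin (n + 1), ∑ σ ∈ shuffles p n,
      (Int.negOnePow ((p : ℤ) * ((n - p : ℕ) : ℤ)) * koszulChi σ deg) •
        μ (n - p + 1)
          (Fin.cons (μ p (fun i : Fin p => a (σ ⟨i.val, by omega⟩)))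
            (fun j : Fin (n - p) => a (σ ⟨p.val + j.val, by omega⟩))) = 0 := by
  rw [Fin.sum_univ_succ]
  convert zero_add (0 : A.H η) using 2
  · refine Finset.sum_eq_zero fun σ _ => ?_
    have h0 : μ ((0 : Fin (n + 1)) : ℕ) = 0 := hμ₀
    rw [h0, zero_apply, MultilinearMap.map_coord_zero _ 0 rfl, smul_zero]
  rcases n with _ | m
  · simp
  -- Generator 0 is the parameter `ζ` of degree `-1`; the remaining ones are the coefficients of the
  -- generic element.
  obtain ⟨M, ε, φ, hM, hε, hφ⟩ := exists_isGradedNil k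
    (Fin.cons (-1) fun i => 1 - deg i : Fin (m + 1 + 1) → ℤ)
  have hζ : M (-1) (ε 0) := hε 0
  have hr : ∀ i : Fin (m + 1), M (1 - deg i) (ε i.succ) := fun i => hε i.succ
  have ha' : ∀ i, (a i : L) ∈ A.gr (deg i) := ha
  have hx := sum_tmul_mem_totalDegree hr ha'
  have hd : (tensorOddLie hM hη).d (∑ i : Fin (m + 1), ε i.succ ⊗ₜ[k] (a i : L)) = 0 := by
    change A.d.lTensor _ _ = 0
    rw [map_sum]
    refine Finset.sum_eq_zero fun i _ => ?_
    rw [LinearMap.lTensor_tmul, hη.d_of_mem_H (a i).2, TensorProduct.tmul_zero]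
  have h := congrArg ((LinearMap.mulLeft k (ε 0)).rTensor L)
    ((tensorOddLie hM hη).sum_DF_F hx hd m)
  -- The `p`-th summand is the Jacobi term with inner arity `p + 1`; arity 0 was removed above using
  -- `μ 0 = 0`.
  rw [map_zero, Finset.Nat.sum_antidiagonal_eq_sum_range_succ_mk, Finset.sum_range, map_sum,
    Finset.sum_congr rfl fun (p : Fin (m + 1)) _ => (congrArg (fun q =>
      (LinearMap.mulLeft k (ε 0)).rTensor L ((tensorOddLie hM hη).DF _
        ((tensorOddLie hM hη).F _ p) q)) (Nat.add_sub_add_right m 1 p).symm).trans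
      (mulLeft_DF_F (p := p) (q := m + 1 - (p + 1)) (n := m + 1) hM hη hμ₁ hμ (by omega) hr ha hζ), ← TensorProduct.tmul_sum] at h
  obtain ⟨s, hs⟩ := koszulProd_eq_smul_prod (k := k) deg (fun i => ε i.succ)
    (List.finRange (m + 1))
  have hφ' : φ (ε 0 * koszulProd k deg (fun i => ε i.succ) (List.finRange (m + 1))) = sg k s := by
    rw [List.ofFn_succ, List.prod_cons] at hφ
    rw [hs, mul_smul_comm, map_smul, ← List.ofFn_eq_map, hφ, smul_eq_mul, mul_one]
  have h1 := eq_zero_of_tmul_eq_zero φ hφ' h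
  rw [← AddSubmonoidClass.coe_finsetSum, ZeroMemClass.coe_eq_zero] at h1
  exact h1

end

theorem mainTheorem3 {k L : Type*} [CommRing k] [Invertible (2 : k)] [AddCommGroup L] [Module k L]
    (A : DGLieAlgebra k L) (η : L →ₗ[k] L) (hη : A.IsSplitting η) :
    ∃ μ : (n : ℕ) → MultilinearMap k (fun _ : Fin n => A.H η) (A.H η),
      IsMinimalLInfinityAlgebra (A.grH η) μ ∧
      (∀ a b : A.H η,
        (μ 2 ![a, b] : L) = A.bracket a b - A.d (η (A.bracket a b))) ∧
      (∀ n : ℕ, 2 ≤ n → ∀ (deg : Fin n → ℤ) (a : Fin n → A.H η),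
        (∀ i, a i ∈ A.grH η (deg i)) →
          (μ n a : L) = hη.treeBracket n deg (fun i => (a i : L))) := by
  obtain ⟨μ, hμ₀, hμ₁, hμ⟩ := exists_brackets hη
  have hμ' : ∀ n, n < 2 → μ n = 0 := fun n hn => by
    interval_cases n
    · exact hμ₀
    · exact hμ₁
  refine ⟨μ, ⟨⟨hη.isInternal_grH, fun n deg a ha => ?_, fun n deg a ha σ => ?_,
    brackets_jacobi hη hμ₀ hμ₁ hμ⟩, hμ₀, hμ₁⟩, binary_bracket_eq hη (hμ 2 le_rfl), hμ⟩
  · rcases lt_or_ge n 2 with hn | hn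
    · rw [hμ' n hn, zero_apply]
      exact Submodule.zero_mem _
    · change (μ n a : L) ∈ A.gr _
      rw [hμ n hn deg a ha]
      exact treeBracket_mem_gr hη hn deg _ ha
  · rcases lt_or_ge n 2 with hn | hn
    · rw [hμ' n hn, zero_apply, zero_apply, smul_zero]
    · refine Subtype.ext ?_
      rw [hμ n hn (fun i => deg (σ i)) _ fun i => ha (σ i), unit_smul k, Submodule.coe_smul,
        hμ n hn deg a ha, ← unit_smul k]
      exact treeBracket_antisymm hη hn ha σ
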